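/- **Setting.** An instance of the (unrooted) repairman problem consists of $n\ge 1$ service requests at nodes of a metric graph, each with a time window $[w,w+\ell)$ with $1\le \ell<2$. A service run at speed $s$ visits distinct requests, each at a time inside its window, so that the distance between consecutively visited requests is at most $s$ times the elapsed time; it may start at any request at any time. Its profit is the number of requests it services. For a period length $\alpha$ and a starting point $\delta$, the periods are $[\delta+k\alpha,\delta+(k+1)\alpha)$, $k\in\mathbb Z$. A window completely fills a period if it contains it; a window beginning exactly at a division is treated as beginning just after it. $W_\ell$ is the set of windows completely filling exactly $\ell$ periods of length $1/2$. An instance has trimmed windows if every window is a period of one fixed set of periods (or has vanished). Assume that an algorithm is given which, for trimmed windows and any speed on the metric graph considered, computes a $\gamma$-approximation in at most $\Gamma(n)$ steps on $n$ requests, where $\Gamma(n)\ge n$. Steps are elementary real-number operations, comparisons, roundings and list operations. **Algorithm.** Let $s=q/r$ with integers $q,r\ge 1$. SPEEDUP, for a period length $\alpha$, starting point $\sigma$ and a choice $(j,k)$, considers the sets of periods with starting points $\sigma+d\alpha/r$, $0\le d<r$ (or, if the end points of the windows have fewer than $r$ distinct remainders modulo $\alpha$, the sets of periods starting at these remainders,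 which represent all distinct sets of periods). For each, it trims every window that completely fills one, two or three periods to its first, $j$-th or $k$-th such period, respectively (other windows vanish), runs the given algorithm at speed $s$, and keeps the best run. SPEEDUPW12 returns the best run found by SPEEDUP for $\alpha=\tfrac12$, $\sigma\in\{0,\tfrac14\}$, $j\in\{1,2\}$, $k\in\{1,2,3\}$; for $\alpha=\tfrac34$, $\sigma\in\{0,\tfrac14,\tfrac12\}$, $j\in\{1,2\}$; and for $\alpha=1$, $\sigma\in\{0,\tfrac14,\tfrac12,\tfrac34\}$. Let $m$ be the number of distinct sets of periods of length $\tfrac12$, two being the same if every window completely fills the same periods (by index) of both, for starting points in $[0,\tfrac12)$. **Theorem.** Let $3\le s\le 5$, $s=q/r$. On windows in $W_2$, SPEEDUPW12 finds a $4\gamma/(s-1)$-approximation in $O(\min\{r,m\}\,\Gamma(n))$ time. That is, SPEEDUPW12 outputs a service run $\hat R$ at speed $s$ such that for every service run $R^*$ at unit speed (in particular an optimal one), the number of requests serviced by $R^*$ whose windows lie in $W_2$ for each of the $r$ sets of periods with starting points $d/(2r)$, $0\le d<r$, is at most $\frac{4\gamma}{s-1}\,\mathrm{profit}(\hat R)$;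 and the number of steps is at most $C\min\{r,m\}\,\Gamma(n)$ with an absolute constant $C$. The same holds for every real $s\in[3,5]$ with $r=\infty$, where SPEEDUP uses all distinct sets of periods, $W_2$ refers to all starting points in $[0,\tfrac12)$, and the time is $O(m\,\Gamma(n))$. -/

import Mathlib

noncomputable section

namespace Repairman

/-! ## Step counting

A computation carries its result together with the number of elementary steps it has used.  The
elementary steps are those of a random access machine with real registers: arithmetic, comparison
and rounding of numbers, and handling one cell of a list or table, cost one step each. -/

/-- The outcome of a computation, and the number of elementary steps that it took. -/
structure Timed (α : Type) where
  val : α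
  cost : ℕ

namespace Timed

/-- Costs add up when computations are performed one after the other. -/
instance : Monad Timed where
  pure a := ⟨a, 0⟩
  bind x f := ⟨(f x.val).val, x.cost + (f x.val).cost⟩

def add (x y : ℝ) : Timed ℝ := ⟨x + y, 1⟩
def sub (x y : ℝ) : Timed ℝ := ⟨x - y, 1⟩
def mul (x y : ℝ) : Timed ℝ := ⟨x * y, 1⟩
def div (x y : ℝ) : Timed ℝ := ⟨x / y, 1⟩
def floor (x : ℝ) : Timed ℤ := ⟨⌊x⌋, 1⟩

open Classical in
def eq (x y : ℝ) : Timed Bool := ⟨decide (x = y), 1⟩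

def intAdd (a b : ℤ) : Timed ℤ := ⟨a + b, 1⟩
def intSub (a b : ℤ) : Timed ℤ := ⟨a - b, 1⟩
def intEq (a b : ℤ) : Timed Bool := ⟨decide (a = b), 1⟩
def succ (c : ℕ) : Timed ℕ := ⟨c + 1, 1⟩

open Classical in
def countLt (c : ℕ) (r : ℕ∞) : Timed Bool := ⟨decide ((c : ℕ∞) < r), 1⟩

def cons {α : Type} (a : α) (l : List α) : Timed (List α) := ⟨a :: l, 1⟩

/-- Fill a table with `n` cells, the cell `p` with the result of `f p`. -/
def table {α : Type} {n : ℕ} (f : Fin n → Timed α) : Timed (Fin n → α) :=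
  ⟨fun p => (f p).val, ∑ p, ((f p).cost + 1)⟩

/-- Go through a list, updating a state with `f` at each entry. -/
def loop {α β : Type} (f : β → α → Timed β) : β → List α → Timed β
  | b, [] => ⟨b, 1⟩
  | b, a :: l => ⟨(loop f (f b a).val l).val, (f b a).cost + 1 + (loop f (f b a).val l).cost⟩

/-- The longer of two lists (the first one, if they have the same length), found by running
through both. -/
def longer {α : Type} (a b : List α) : Timed (List α) :=
  ⟨if a.length < b.length then b else a, a.length + b.length + 1⟩

end Timed

/-! ## The repairman problem -/

/-- A service request at a node of the metric graph `V`, with time window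
`[start, start + len)`. -/
structure Request (V : Type*) where
  loc : V
  start : ℝ
  len : ℝ

def Request.window {V : Type*} (p : Request V) : Set ℝ := Set.Ico p.start (p.start + p.len)

/-- A service run on `n` requests: the requests serviced, in order, each with the time at which it
is serviced. -/
abbrev Run (n : ℕ) : Type := List (Fin n × ℝ)

/-- `R` is a service run at speed `s` for requests at the nodes `loc` with time windows `window`:
no request occurs twice, each is serviced inside its window, and the distance from each request to
the next one can be covered at speed `s` in the time between the two services.  The run may start
at any request at any time. -/
def IsServiceRun {V : Type*} [MetricSpace V] {n : ℕ} (loc : Fin n → V) (window : Fin n → Set ℝ)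
    (s : ℝ) (R : Run n) : Prop :=
  (R.map Prod.fst).Nodup ∧ (∀ x ∈ R, x.2 ∈ window x.1) ∧
    R.IsChain (fun x y => dist (loc x.1) (loc y.1) ≤ s * (y.2 - x.2))

/-- The profit of a run is the number of requests that it services. -/
def profit {n : ℕ} (R : Run n) : ℕ := R.length

/-- The profit that a run collects from the requests in `S`. -/
def profitOn {n : ℕ} (S : Set (Fin n)) (R : Run n) : ℕ :=
  {p : Fin n | p ∈ S ∧ ∃ t, (p, t) ∈ R}.ncard

/-- `R` is a service run at speed `s` for the instance `I`. -/
def IsRunOf {V : Type*} [MetricSpace V] {n : ℕ} (I : Fin n → Request V) (s : ℝ) (R : Run n) :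
    Prop :=
  IsServiceRun (fun p => (I p).loc) (fun p => (I p).window) s R

/-! ## Periods and trimming

The set of periods of length `α` with starting point `δ` consists of the periods
`[δ + k α, δ + (k + 1) α)` with `k` an integer. -/

/-- The window of `p` completely fills the period with index `k`.  A window that begins at a
division is treated as beginning just after it (no window is to start at the beginning of a
period), so it does not fill the period beginning there. -/
def Fills {V : Type*} (α δ : ℝ) (p : Request V) (k : ℤ) : Prop :=
  p.start < δ + k * α ∧ δ + (k + 1) * α ≤ p.start + p.len

/-- `W_ℓ`: the requests whose window completely fills exactly `ℓ` periods. -/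
def WSet {V : Type*} {n : ℕ} (I : Fin n → Request V) (α δ : ℝ) (l : ℕ) : Set (Fin n) :=
  {p | {k : ℤ | Fills α δ (I p) k}.encard = l}

/-- Starting points of the sets of periods of length `1/2` used for speedup `q / r`: these are
`d / (2 r)` for `d = 0, …, r - 1`, and all of `[0, 1/2)` if `r = ∞`. -/
def startingPoints (r : ℕ∞) : Set ℝ :=
  {δ | δ ∈ Set.Ico (0 : ℝ) (1 / 2) ∧ ∀ r' : ℕ, r = r' → ∃ d : ℕ, δ = d / (2 * r')}

/-- The number of distinct sets of periods of length `α`: two sets of periods count as the same if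
every window completely fills the same periods of both. -/
def numPeriodSets {V : Type*} {n : ℕ} (I : Fin n → Request V) (α : ℝ) : ℕ∞ :=
  ((fun (δ : ℝ) (p : Fin n) => {k : ℤ | Fills α δ (I p) k}) '' Set.Ico (0 : ℝ) α).encard

/-- An instance with trimmed windows: a speed, a set of periods, and for each of `n` requests its
node and the index of the period that is its window (`none` if its window has vanished). -/
structure TrimmedInstance (V : Type*) (n : ℕ) where
  speed : ℝ
  period : ℝ
  origin : ℝ
  loc : Fin n → V
  slot : Fin n → Option ℤ

def TrimmedInstance.window {V : Type*} {n : ℕ} (T : TrimmedInstance V n) (p : Fin n) : Set ℝ :=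
  {t | ∃ k : ℤ, T.slot p = some k ∧
    t ∈ Set.Ico (T.origin + k * T.period) (T.origin + (k + 1) * T.period)}

/-- `alg` is a `γ`-approximation algorithm for the repairman problem with trimmed windows on the
metric graph `V`, and it takes at most `Γ n` steps on `n` requests. -/
def IsTrimmedRepairmanAlgorithm {V : Type*} [MetricSpace V]
    (alg : (n : ℕ) → TrimmedInstance V n → Timed (Run n)) (γ : ℝ) (Γ : ℕ → ℕ) : Prop :=
  ∀ (n : ℕ) (T : TrimmedInstance V n), 0 < T.speed → 0 < T.period →
    IsServiceRun T.loc T.window T.speed (alg n T).val ∧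
    (∀ R : Run n, IsServiceRun T.loc T.window T.speed R →
      (profit R : ℝ) ≤ γ * profit (alg n T).val) ∧
    (alg n T).cost ≤ Γ n

/-! ## The algorithm -/

/-- Trim a window: if it completely fills one period keep that one, if it fills two keep the
`j`-th, if it fills three keep the `k`-th, and otherwise let it vanish. -/
def trim {V : Type*} (α δ : ℝ) (j k : ℤ) (p : Request V) : Timed (Option ℤ) := do
  let w ← Timed.sub p.start δ
  let w ← Timed.div w α
  let w ← Timed.floor w
  let first ← Timed.intAdd w 1
  let e ← Timed.add p.start p.len
  let e ← Timed.sub e δ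
  let e ← Timed.div e α
  let e ← Timed.floor e
  let count ← Timed.intSub e first
  let c1 ← Timed.intEq count 1
  let c2 ← Timed.intEq count 2
  let c3 ← Timed.intEq count 3
  let before ← Timed.intSub first 1
  let atj ← Timed.intAdd before j
  let atk ← Timed.intAdd before k
  pure (if c1 then some first else if c2 then some atj else if c3 then some atk else none)

/-- The remainder of a time modulo the period length. -/
def remainder (α x : ℝ) : Timed ℝ := do
  let a ← Timed.div x α
  let a ← Timed.floor a
  let a ← Timed.mul a α
  Timed.sub x a

/-- Is `x` in the list? -/
def member (x : ℝ) : List ℝ → Timed Bool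
  | [] => ⟨false, 1⟩
  | y :: l => do
    let b ← Timed.eq x y
    if b then pure true else member x l

/-- Go through a list of times and add to `acc` (which holds `c` entries) the new remainders modulo
`α`.  Give up with `none` as soon as there are `r` distinct ones. -/
def collect (α : ℝ) (r : ℕ∞) : List ℝ → ℕ → List ℝ → Timed (Option (List ℝ))
  | acc, _, [] => ⟨some acc, 1⟩
  | acc, c, x :: l => do
    let y ← remainder α x
    let old ← member y acc
    if old then collect α r acc c l
    else
      let c ← Timed.succ c
      let b ← Timed.countLt c r
      if b then
        let acc ← Timed.cons y acc
        collect α r acc c l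
      else pure none

/-- The list of all starting times and finishing times of windows. -/
def endpoints {V : Type*} : List (Request V) → Timed (List ℝ)
  | [] => ⟨[], 1⟩
  | p :: l => do
    let e ← Timed.add p.start p.len
    let t ← endpoints l
    let t ← Timed.cons e t
    Timed.cons p.start t

/-- The list of the points `σ + d h` for `d < r`. -/
def shifts (σ h : ℝ) : ℕ → Timed (List ℝ)
  | 0 => ⟨[], 1⟩
  | d + 1 => do
    let x ← Timed.mul d h
    let y ← Timed.add σ x
    let l ← shifts σ h d
    Timed.cons y l

/-- The starting points of the sets of periods tried by SPEEDUP.  They are `σ + d α / r` for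
`d = 0, …, r - 1`, except when the end points of the windows have fewer than `r` remainders
modulo `α`; then these remainders are used, since they already represent all distinct sets of
periods. -/
def periodSets {V : Type*} {n : ℕ} (I : Fin n → Request V) (α σ : ℝ) (r : ℕ∞) :
    Timed (List ℝ) := do
  let t ← endpoints (List.ofFn I)
  let a ← collect α r [] 0 t
  match a with
  | some l => pure l
  | none =>
    let h ← Timed.div α r.toNat
    shifts σ h r.toNat

/-- SPEEDUP at speed `s` with periods of length `α`, starting point `σ` and trimming choices
`j`, `k`: for each set of periods, trim the windows, call the algorithm `alg` for trimmed windows,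
and keep the best run found so far. -/
def speedup {V : Type*} (alg : (n : ℕ) → TrimmedInstance V n → Timed (Run n)) (s : ℝ) (r : ℕ∞)
    {n : ℕ} (I : Fin n → Request V) (α σ : ℝ) (j k : ℤ) (best : Run n) : Timed (Run n) := do
  let D ← periodSets I α σ r
  Timed.loop (fun best δ => do
    let slot ← Timed.table fun p => trim α δ j k (I p)
    let R ← alg n ⟨s, α, δ, fun p => (I p).loc, slot⟩
    Timed.longer best R) best D

/-- SPEEDUPW12.  (Windows of length less than 2 never fill three periods of length 3/4 or two
periods of length 1, so the unused trimming choices in the last two phases have no effect.) -/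
def speedupW12 {V : Type*} (alg : (n : ℕ) → TrimmedInstance V n → Timed (Run n)) (s : ℝ) (r : ℕ∞)
    {n : ℕ} (I : Fin n → Request V) : Timed (Run n) := do
  let best ← Timed.loop (fun best (i : ℕ) => do
    let σ ← Timed.div i 4
    Timed.loop (fun best (j : ℤ) =>
      Timed.loop (fun best (k : ℤ) => speedup alg s r I (1 / 2) σ j k best) best [1, 2, 3])
      best [1, 2]) [] [0, 1]
  let best ← Timed.loop (fun best (i : ℕ) => do
    let σ ← Timed.div i 4
    Timed.loop (fun best (j : ℤ) => speedup alg s r I (3 / 4) σ j 1 best) best [1, 2])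
    best [0, 1, 2]
  Timed.loop (fun best (i : ℕ) => do
    let σ ← Timed.div i 4
    speedup alg s r I 1 σ 1 1 best) best [0, 1, 2, 3]

end Repairman

end

noncomputable section

namespace Repairman

/-! Fix a unit-speed run and the set `S` of its requests that lie in `W_2` for every starting point.
A real function `φ` with Lipschitz constant `s` gives a run at speed `s` that is at time `t` where
the unit-speed run is at time `φ t` (`exists_run_of_position`). For each set of periods, four such
functions are used: zigzags of period 1 that gain `(s + 1) / 2`, lose `(s - 1) / 2`, and hence
advance by 1. They come in two parities, each in a version lagging behind and a version running
ahead.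

Trim every window in `W_2` to its first filled period, beginning at `T`. A request serviced at time
`τ` by the unit-speed run has offset `x = τ - T` in `[-1/2, 3/2)`. Of the four zigzags, at least
`multiplicity s` pass `τ` during the trimmed window, or one fewer if `x` lies within `margin s` of
an end of that range (`multiplicity_le_card_reaches`). Over `N` equidistant starting points, a
request falls into these end pieces at most `⌈2 N margin⌉` times (`card_margin_le`). Since
`multiplicity - 2 margin = s - 1`, averaging over the `4 N` runs yields one that services about `(s
- 1) / 4` of `S` (`exists_trimmed_run`). For `s = q / r` and `N = r` the ceiling is exact; for `r =
∞` its error vanishes as `N` grows (`profitOn_le`).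

If SPEEDUP uses remainders instead of equidistant points, every set of periods agrees with one of
those tried, up to reindexing and a shift in time (`exists_remainder_run`). The number of sets tried
is bounded by `r` and by the number of remainders, which for length 1/2 is at most `m` and for the
other lengths at most six times as large (`card_remainders_le_numPeriodSets`, `card_remainders_le`).
-/

/-! ### Reparametrising a unit-speed run -/

/-- A unit-speed run moves no farther than the time that elapses between any two of its services. -/
theorem IsServiceRun.dist_le {V : Type*} [MetricSpace V] {n : ℕ} {loc : Fin n → V}
    {window : Fin n → Set ℝ} {R : Run n} (hR : IsServiceRun loc window 1 R)
    {x y : Fin n × ℝ} (hx : x ∈ R) (hy : y ∈ R) :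
    dist (loc x.1) (loc y.1) ≤ |x.2 - y.2| := by
  obtain ⟨-, -, hc⟩ := hR
  have htrans : IsTrans (Fin n × ℝ) (fun x y => dist (loc x.1) (loc y.1) ≤ 1 * (y.2 - x.2)) :=
    ⟨fun a b c h1 h2 => by
      have := dist_triangle (loc a.1) (loc b.1) (loc c.1)
      linarith⟩
  have hp := List.isChain_iff_pairwise.mp hc
  have hp' : R.Pairwise (fun x y => dist (loc x.1) (loc y.1) ≤ |x.2 - y.2|) :=
    hp.imp fun {a b} h => by
      rw [abs_sub_comm]
      exact (by linarith : _ ≤ b.2 - a.2).trans (le_abs_self _)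
  have hsymm : Std.Symm fun x y : Fin n × ℝ => dist (loc x.1) (loc y.1) ≤ |x.2 - y.2| :=
    ⟨fun a b h => by rwa [dist_comm, abs_sub_comm]⟩
  exact hp'.forall_of_forall (fun a _ => by simp) hx hy

/-- A position function along a unit-speed run that has Lipschitz constant `s` yields a run at
speed `s` that services every request found at its position during its new window. -/
theorem exists_run_of_position {V : Type*} [MetricSpace V] {n : ℕ} {loc : Fin n → V}
    {window window' : Fin n → Set ℝ} {R : Run n} (hR : IsServiceRun loc window 1 R) {s : ℝ}
    {φ : ℝ → ℝ} (hφ : ∀ t t', t ≤ t' → |φ t' - φ t| ≤ s * (t' - t)) (S : Finset (Fin n))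
    (hS : ∀ p ∈ S, ∃ t ∈ window' p, (p, φ t) ∈ R) :
    ∃ R' : Run n, IsServiceRun loc window' s R' ∧ profit R' = S.card := by
  classical
  have hS' : ∀ p : Fin n, ∃ t : ℝ, p ∈ S → t ∈ window' p ∧ (p, φ t) ∈ R := by
    intro p
    by_cases hp : p ∈ S
    · obtain ⟨t, h1, h2⟩ := hS p hp
      exact ⟨t, fun _ => ⟨h1, h2⟩⟩
    · exact ⟨0, fun h => absurd h hp⟩
  choose t ht using hS'
  -- The new run takes requests by their new times; where `φ` decreases this reverses the order of
  -- `R`.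
  let l := S.toList.mergeSort (fun p q => decide (t p ≤ t q))
  have hperm : l.Perm S.toList := List.mergeSort_perm _ _
  have hsorted : l.Pairwise (fun p q => t p ≤ t q) := by
    have := List.pairwise_mergeSort (le := fun p q => decide (t p ≤ t q))
      (by intro a b c; simp only [decide_eq_true_eq]; exact le_trans)
      (by intro a b; simpa using le_total (t a) (t b)) S.toList
    exact this.imp (by simp)
  have hmem : ∀ p ∈ l, p ∈ S := fun p hp => by simpa using hperm.mem_iff.mp hp
  refine ⟨l.map fun p => (p, t p), ⟨?_, ?_, ?_⟩, ?_⟩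
  · have : (l.map fun p => (p, t p)).map Prod.fst = l := by
      simp [Function.comp_def]
    rw [this]
    exact hperm.nodup_iff.mpr S.nodup_toList
  · intro x hx
    obtain ⟨p, hp, rfl⟩ := List.mem_map.mp hx
    exact (ht p (hmem p hp)).1
  · apply List.Pairwise.isChain
    rw [List.pairwise_map]
    refine hsorted.imp_of_mem fun {p q} hp hq hpq => ?_
    have h1 := hR.dist_le (ht p (hmem p hp)).2 (ht q (hmem q hq)).2
    rw [abs_sub_comm] at h1
    exact h1.trans (hφ _ _ hpq)
  · simp [profit, hperm.length_eq]

/-! ### The zigzag function -/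

/-- The zigzag with slopes `s` and `-s` that turns upwards at each `(k, k)`, `k` an integer. -/
def zigzag (s t : ℝ) : ℝ := ⌊t⌋ + min (s * Int.fract t) (1 + s * (1 - Int.fract t))

/-- Allowing the right end point `k + 1`, where the floor jumps but both formulas give `k + 1`, lets
neighbouring pieces be glued. -/
theorem zigzag_eq (s t : ℝ) (k : ℤ) (h0 : k ≤ t) (h1 : t ≤ k + 1) (hs : 1 ≤ s) :
    zigzag s t = k + min (s * (t - k)) (1 + s * (1 - (t - k))) := by
  rcases h1.lt_or_eq with h | h
  · have : ⌊t⌋ = k := Int.floor_eq_iff.mpr ⟨h0, h⟩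
    rw [zigzag, Int.fract, this]
  · have : ⌊t⌋ = k + 1 := by rw [h]; simp
    rw [zigzag, Int.fract, this, h]
    push_cast
    rw [min_eq_left (by nlinarith), min_eq_right (by nlinarith)]
    ring

theorem abs_zigzag_sub_le_of_mem {s : ℝ} (hs : 1 ≤ s) (k : ℤ) {t t' : ℝ} (h0 : k ≤ t)
    (h : t ≤ t') (h1 : t' ≤ k + 1) : |zigzag s t' - zigzag s t| ≤ s * (t' - t) := by
  rw [zigzag_eq s t k h0 (by linarith) hs, zigzag_eq s t' k (by linarith) h1 hs]
  have hst : 0 ≤ s * (t' - t) := by apply mul_nonneg <;> linarith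
  rw [abs_le]
  constructor <;>
  rcases min_cases (s * (t - k)) (1 + s * (1 - (t - k))) with h2 | h2 <;>
  rcases min_cases (s * (t' - k)) (1 + s * (1 - (t' - k))) with h3 | h3 <;> nlinarith

theorem zigzag_intCast {s : ℝ} (hs : 1 ≤ s) (k : ℤ) : zigzag s k = k := by
  rw [zigzag_eq s k k le_rfl (by linarith) hs]
  rw [min_eq_left (by nlinarith)]
  ring

/-- Across several pieces, pass through the integers `⌊t⌋ + 1` and `⌊t'⌋`: the end pieces obey the
bound, and between integers the zigzag has mean slope `1 ≤ s`. -/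
theorem abs_zigzag_sub_le {s : ℝ} (hs : 1 ≤ s) {t t' : ℝ} (h : t ≤ t') :
    |zigzag s t' - zigzag s t| ≤ s * (t' - t) := by
  have hk0 := Int.floor_le t
  have hk1 := Int.lt_floor_add_one t
  have hl0 := Int.floor_le t'
  have hl1 := Int.lt_floor_add_one t'
  rcases (Int.floor_le_floor h).lt_or_eq with hlt | heq
  · have h1 := abs_zigzag_sub_le_of_mem hs ⌊t⌋ hk0 hk1.le le_rfl
    have h2 := abs_zigzag_sub_le_of_mem hs ⌊t'⌋ le_rfl hl0 hl1.le
    have e : zigzag s (⌊t⌋ + 1) = ⌊t⌋ + 1 := by exact_mod_cast zigzag_intCast hs (⌊t⌋ + 1)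
    rw [e] at h1
    rw [zigzag_intCast hs] at h2
    have h3 : (⌊t⌋ : ℝ) + 1 ≤ ⌊t'⌋ := by exact_mod_cast hlt
    have h4 : ((⌊t'⌋ : ℝ) - (⌊t⌋ + 1)) ≤ s * (⌊t'⌋ - (⌊t⌋ + 1)) := by nlinarith
    rw [abs_le] at *
    constructor <;> nlinarith
  · exact abs_zigzag_sub_le_of_mem hs ⌊t⌋ hk0 h (by rw [heq]; exact hl1.le)

/-- The zigzag on its way up. -/
theorem zigzag_up {s : ℝ} (hs : 1 ≤ s) (k : ℤ) {t : ℝ} (h0 : 0 ≤ s * (t - k))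
    (h1 : s * (t - k) ≤ (s + 1) / 2) : zigzag s t = k + s * (t - k) := by
  have h0' : (0 : ℝ) ≤ t - k := nonneg_of_mul_nonneg_right h0 (by linarith)
  have h1' : t - k ≤ 1 := by
    by_contra! h
    nlinarith
  rw [zigzag_eq s t k (by linarith) (by linarith) hs, min_eq_left (by nlinarith)]

/-- The zigzag on its way down. -/
theorem zigzag_down {s : ℝ} (hs : 1 ≤ s) (k : ℤ) {t : ℝ} (h0 : 0 ≤ s * (k - t))
    (h1 : s * (k - t) ≤ (s - 1) / 2) : zigzag s t = k + s * (k - t) := by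
  have h0' : (0 : ℝ) ≤ k - t := nonneg_of_mul_nonneg_right h0 (by linarith)
  have h1' : k - t ≤ 1 := by
    by_contra! h
    nlinarith
  rw [zigzag_eq s t (k - 1) (by push_cast; linarith) (by push_cast; linarith) hs]
  push_cast
  rw [min_eq_right (by nlinarith)]
  ring

/-! ### Four zigzagging runs and the offsets they reach -/

/-- The position at time `t`, as a time on the unit-speed run, of a zigzagging run at speed `s`.
The periods are `[δ + k / 2, δ + (k + 1) / 2)`; the zigzag moves forward mainly in the periods with
odd `k` (if `odd`) or even `k` (if not), and is ahead of the standard one if `ahead`. -/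
def position (s δ : ℝ) (odd ahead : Bool) (t : ℝ) : ℝ :=
  let b := δ + (if odd then 1 else 0) / 2
  if ahead then zigzag s (t - b - min 0 ((4 - s) / (2 * s))) + (b + (3 - s) / 2)
  else zigzag s (t - b + 1 / (2 * s)) + (b - 1)

theorem abs_position_sub_le {s : ℝ} (hs : 1 ≤ s) (δ : ℝ) (odd ahead : Bool) {t t' : ℝ}
    (h : t ≤ t') : |position s δ odd ahead t' - position s δ odd ahead t| ≤ s * (t' - t) := by
  unfold position
  cases ahead
  · simp only [Bool.false_eq_true, if_false, add_sub_add_right_eq_sub]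
    convert abs_zigzag_sub_le hs (t := t - (δ + (if odd then 1 else 0) / 2) + 1 / (2 * s))
      (t' := t' - (δ + (if odd then 1 else 0) / 2) + 1 / (2 * s)) (by linarith) using 2
    ring
  · simp only [if_true, add_sub_add_right_eq_sub]
    convert abs_zigzag_sub_le hs
      (t := t - (δ + (if odd then 1 else 0) / 2) - min 0 ((4 - s) / (2 * s)))
      (t' := t' - (δ + (if odd then 1 else 0) / 2) - min 0 ((4 - s) / (2 * s)))
      (by linarith) using 2
    ring

/-- The shift by `1 / (2 s)` puts the zigzag at offset `-1/2` when the period begins and at its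
peak, offset `(s - 1) / 2`, when it ends. -/
theorem exists_zigzag_behind_forward {s : ℝ} (hs3 : 3 ≤ s) (b : ℝ) (i : ℤ) {x : ℝ}
    (hx0 : -(1 / 2) ≤ x) (h : x < (s - 1) / 2) :
    ∃ t ∈ Set.Ico (b + i) (b + i + 1 / 2),
      zigzag s (t - b + 1 / (2 * s)) + (b - 1) = b + i + x := by
  have hs0 : 0 < s := by linarith
  have e : s * (b + i + (x + 1 / 2) / s - b + 1 / (2 * s) - i) = x + 1 := by field_simp; ring
  refine ⟨b + i + (x + 1 / 2) / s, ⟨?_, ?_⟩, ?_⟩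
  · have : 0 ≤ (x + 1 / 2) / s := div_nonneg (by linarith) hs0.le
    linarith
  · have : (x + 1 / 2) / s < 1 / 2 := by rw [div_lt_iff₀ hs0]; linarith
    linarith
  · rw [zigzag_up (by linarith) i (by rw [e]; linarith) (by rw [e]; linarith), e]
    ring

/-- The descent starts with the period, at offset `(s - 2) / 2`, and reaches offset `-1/2` before
the period ends. -/
theorem exists_zigzag_behind_backward {s : ℝ} (hs3 : 3 ≤ s) (b : ℝ) (i : ℤ) {x : ℝ}
    (hx0 : -(1 / 2) ≤ x) (h : x ≤ (s - 2) / 2) :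
    ∃ t ∈ Set.Ico (b + i + 1 / 2) (b + i + 1),
      zigzag s (t - b + 1 / (2 * s)) + (b - 1) = b + i + 1 / 2 + x := by
  have hs0 : 0 < s := by linarith
  have e : s * (((i + 1 : ℤ) : ℝ) - (b + i + 1 - (x + 1) / s - b + 1 / (2 * s))) = x + 1 / 2 := by
    push_cast
    field_simp
    ring
  refine ⟨b + i + 1 - (x + 1) / s, ⟨?_, ?_⟩, ?_⟩
  · have : (x + 1) / s ≤ 1 / 2 := by rw [div_le_iff₀ hs0]; linarith
    linarith
  · have : 0 < (x + 1) / s := div_pos (by linarith) hs0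
    linarith
  · rw [zigzag_down (by linarith) (i + 1) (by rw [e]; linarith) (by rw [e]; linarith), e]
    push_cast
    ring

/-- With `θ = 0` the climb starts with the period at offset `(3 - s) / 2` and reaches `3/2` at its
end. For `s > 4` this start lies below the needed `-1/2`, so the zigzag is moved earlier by `-θ`,
just enough to be at `-1/2` when the period begins. -/
theorem exists_zigzag_ahead_forward {s : ℝ} (hs3 : 3 ≤ s) (b : ℝ) (i : ℤ) {x : ℝ}
    (hx0 : -(1 / 2) ≤ x) (hx1 : x < 3 / 2) (h : (3 - s) / 2 ≤ x) :
    ∃ t ∈ Set.Ico (b + i) (b + i + 1 / 2),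
      zigzag s (t - b - min 0 ((4 - s) / (2 * s))) + (b + (3 - s) / 2) = b + i + x := by
  have hs0 : 0 < s := by linarith
  set θ := min 0 ((4 - s) / (2 * s)) with hθ
  have hθ0 : θ ≤ 0 := min_le_left _ _
  have hθ1 : 0 ≤ s * θ + (x - (3 - s) / 2) := by
    have e : s * ((4 - s) / (2 * s)) = (4 - s) / 2 := by field_simp
    rcases min_choice 0 ((4 - s) / (2 * s)) with h' | h' <;> rw [hθ, h']
    · linarith
    · rw [e]; linarith
  have e : s * (b + i + θ + (x - (3 - s) / 2) / s - b - θ - i) = x - (3 - s) / 2 := by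
    field_simp; ring
  refine ⟨b + i + θ + (x - (3 - s) / 2) / s, ⟨?_, ?_⟩, ?_⟩
  · have : 0 ≤ θ + (x - (3 - s) / 2) / s := by
      have := div_nonneg hθ1 hs0.le
      rwa [add_div, mul_div_cancel_left₀ _ hs0.ne'] at this
    linarith
  · have : (x - (3 - s) / 2) / s < 1 / 2 := by rw [div_lt_iff₀ hs0]; linarith
    linarith
  · rw [zigzag_up (by linarith) i (by rw [e]; linarith) (by rw [e]; linarith), e]
    ring

/-- The descent runs from offset `3/2` to `(4 - s) / 2`. Its bottom falls on the excluded end of the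
period if `s ≤ 4`, and strictly inside if `s > 4`; hence the two forms of the bound. The condition
`s ≤ 5` keeps the peak from occurring before this period. -/
theorem exists_zigzag_ahead_backward {s : ℝ} (hs3 : 3 ≤ s) (hs5 : s ≤ 5) (b : ℝ) (i : ℤ)
    {x : ℝ} (hx1 : x < 3 / 2) (h : (4 - s) / 2 < x ∨ 4 < s ∧ (4 - s) / 2 ≤ x) :
    ∃ t ∈ Set.Ico (b + i + 1 / 2) (b + i + 1),
      zigzag s (t - b - min 0 ((4 - s) / (2 * s))) + (b + (3 - s) / 2) = b + i + 1 / 2 + x := by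
  have hs0 : 0 < s := by linarith
  have hx : (4 - s) / 2 ≤ x := by rcases h with h | h <;> linarith
  set θ := min 0 ((4 - s) / (2 * s)) with hθ
  have e' : s * ((4 - s) / (2 * s)) = (4 - s) / 2 := by field_simp
  have hθ0 : s * θ < x + (s - 4) / 2 := by
    rcases h with h | h
    · have : s * θ ≤ 0 := mul_nonpos_of_nonneg_of_nonpos hs0.le (min_le_left _ _)
      linarith
    · have : s * θ ≤ (4 - s) / 2 := by
        rw [← e']
        exact mul_le_mul_of_nonneg_left (min_le_right _ _) hs0.le
      linarith
  have hθ1 : x + (s - 4) / 2 ≤ s / 2 + s * θ := by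
    rcases min_choice 0 ((4 - s) / (2 * s)) with h' | h' <;> rw [hθ, h']
    · linarith
    · rw [e']; linarith
  have e : s * (((i + 1 : ℤ) : ℝ) - (b + θ + i + 1 - (x + (s - 4) / 2) / s - b - θ)) =
      x + (s - 4) / 2 := by
    push_cast
    field_simp
    ring
  refine ⟨b + θ + i + 1 - (x + (s - 4) / 2) / s, ⟨?_, ?_⟩, ?_⟩
  · have : (x + (s - 4) / 2) / s ≤ 1 / 2 + θ := by rw [div_le_iff₀ hs0]; linarith
    linarith
  · have : θ < (x + (s - 4) / 2) / s := by rw [lt_div_iff₀ hs0]; linarith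
    linarith
  · rw [zigzag_down (by linarith) (i + 1) (by rw [e]; linarith) (by rw [e]; linarith), e]
    push_cast
    ring

/-- The zigzagging run is at position `T + x` at some time in the period with index `k`, where `T`
is the beginning of that period. -/
def Reaches (s δ : ℝ) (k : ℤ) (x : ℝ) (odd ahead : Bool) : Prop :=
  ∃ t ∈ Set.Ico (δ + k * (1 / 2)) (δ + (k + 1) * (1 / 2)),
    position s δ odd ahead t = δ + k * (1 / 2) + x

/-- For each version, one parity moves mainly forward in the given period and the other mainly
backward; `odd` names the forward one. -/
theorem exists_reaches {s : ℝ} (hs3 : 3 ≤ s) (hs5 : s ≤ 5) (δ : ℝ) (k : ℤ) {x : ℝ}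
    (hx0 : -(1 / 2) ≤ x) (hx1 : x < 3 / 2) : ∃ odd : Bool,
      (x < (s - 1) / 2 → Reaches s δ k x odd false) ∧
      (x ≤ (s - 2) / 2 → Reaches s δ k x (!odd) false) ∧
      ((3 - s) / 2 ≤ x → Reaches s δ k x odd true) ∧
      ((4 - s) / 2 < x ∨ 4 < s ∧ (4 - s) / 2 ≤ x → Reaches s δ k x (!odd) true) := by
  rcases Int.even_or_odd' k with ⟨i, rfl | rfl⟩
  · refine ⟨false, fun h => ?_, fun h => ?_, fun h => ?_, fun h => ?_⟩
    · obtain ⟨t, ht, e⟩ := exists_zigzag_behind_forward hs3 (δ + 0 / 2) i hx0 h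
      refine ⟨t, ⟨?_, ?_⟩, ?_⟩
      · push_cast; linarith [ht.1]
      · push_cast; linarith [ht.2]
      · simp only [position, Bool.false_eq_true, if_false]
        rw [e]; push_cast; ring
    -- With base `δ + 1/2`, the backward half of cycle `i - 1` begins at `δ + i`, which is the
    -- period with index `2 i`.
    · obtain ⟨t, ht, e⟩ := exists_zigzag_behind_backward hs3 (δ + 1 / 2) (i - 1) hx0 h
      push_cast at ht e
      refine ⟨t, ⟨?_, ?_⟩, ?_⟩
      · push_cast; linarith [ht.1]
      · push_cast; linarith [ht.2]
      · simp only [position, Bool.false_eq_true, if_false, Bool.not_false, if_true]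
        rw [e]; push_cast; ring
    · obtain ⟨t, ht, e⟩ := exists_zigzag_ahead_forward hs3 (δ + 0 / 2) i hx0 hx1 h
      refine ⟨t, ⟨?_, ?_⟩, ?_⟩
      · push_cast; linarith [ht.1]
      · push_cast; linarith [ht.2]
      · simp only [position, Bool.false_eq_true, if_false, if_true]
        rw [e]; push_cast; ring
    · obtain ⟨t, ht, e⟩ := exists_zigzag_ahead_backward hs3 hs5 (δ + 1 / 2) (i - 1) hx1 h
      push_cast at ht e
      refine ⟨t, ⟨?_, ?_⟩, ?_⟩
      · push_cast; linarith [ht.1]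
      · push_cast; linarith [ht.2]
      · simp only [position, Bool.not_false, if_true]
        rw [e]; push_cast; ring
  · refine ⟨true, fun h => ?_, fun h => ?_, fun h => ?_, fun h => ?_⟩
    · obtain ⟨t, ht, e⟩ := exists_zigzag_behind_forward hs3 (δ + 1 / 2) i hx0 h
      refine ⟨t, ⟨?_, ?_⟩, ?_⟩
      · push_cast; linarith [ht.1]
      · push_cast; linarith [ht.2]
      · simp only [position, Bool.false_eq_true, if_false, if_true]
        rw [e]; push_cast; ring
    · obtain ⟨t, ht, e⟩ := exists_zigzag_behind_backward hs3 (δ + 0 / 2) i hx0 h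
      refine ⟨t, ⟨?_, ?_⟩, ?_⟩
      · push_cast; linarith [ht.1]
      · push_cast; linarith [ht.2]
      · simp only [position, Bool.false_eq_true, if_false, Bool.not_true]
        rw [e]; push_cast; ring
    · obtain ⟨t, ht, e⟩ := exists_zigzag_ahead_forward hs3 (δ + 1 / 2) i hx0 hx1 h
      refine ⟨t, ⟨?_, ?_⟩, ?_⟩
      · push_cast; linarith [ht.1]
      · push_cast; linarith [ht.2]
      · simp only [position, if_true]
        rw [e]; push_cast; ring
    · obtain ⟨t, ht, e⟩ := exists_zigzag_ahead_backward hs3 hs5 (δ + 0 / 2) i hx1 h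
      refine ⟨t, ⟨?_, ?_⟩, ?_⟩
      · push_cast; linarith [ht.1]
      · push_cast; linarith [ht.2]
      · simp only [position, Bool.false_eq_true, if_false, if_true, Bool.not_true]
        rw [e]; push_cast; ring

/-- The length of the two end pieces of `[-1/2, 3/2)` that fewer of the four zigzags reach. -/
def margin (s : ℝ) : ℝ := if s ≤ 4 then (4 - s) / 2 else (5 - s) / 2

/-- The number of zigzags, out of four, that reach each position between the end pieces. -/
def multiplicity (s : ℝ) : ℕ := if s ≤ 4 then 3 else 4

theorem multiplicity_sub_margin (s : ℝ) : (multiplicity s : ℝ) - 2 * margin s = s - 1 := by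
  unfold multiplicity margin
  split_ifs <;> push_cast <;> ring

-- Intersecting the four ranges of offsets: for `s ≤ 4`, three zigzags reach the middle and two
-- reach each end piece; for `s > 4`, the forward ones reach everything and each backward one misses
-- at most one end piece.
open Classical in
theorem multiplicity_le_card_reaches {s : ℝ} (hs3 : 3 ≤ s) (hs5 : s ≤ 5) (δ : ℝ) (k : ℤ) {x : ℝ}
    (hx0 : -(1 / 2) ≤ x) (hx1 : x < 3 / 2) :
    multiplicity s ≤ (Finset.univ.filter fun c : Bool × Bool => Reaches s δ k x c.1 c.2).card +
      if x < -(1 / 2) + margin s ∨ 3 / 2 - margin s ≤ x then 1 else 0 := by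
  obtain ⟨odd, h1, h2, h3, h4⟩ := exists_reaches hs3 hs5 δ k hx0 hx1
  have hcard : (Finset.univ.filter fun c : Bool × Bool => Reaches s δ k x c.1 c.2).card =
      (if Reaches s δ k x odd false then 1 else 0) + (if Reaches s δ k x (!odd) false then 1 else 0)
      + (if Reaches s δ k x odd true then 1 else 0)
      + (if Reaches s δ k x (!odd) true then 1 else 0) := by
    rw [Finset.card_filter, Fintype.sum_prod_type]
    cases odd <;> simp only [Fintype.sum_bool, Bool.not_true, Bool.not_false] <;> omega
  rw [hcard]
  unfold multiplicity margin
  by_cases hs : s ≤ 4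
  · simp only [hs, if_true]
    by_cases ha : x < (3 - s) / 2
    · rw [if_pos (h1 (by linarith)), if_pos (h2 (by linarith)), if_pos (Or.inl (by linarith))]
      omega
    -- The two backward ranges together cover everything, since `(4 - s) / 2 ≤ 1 / 2 ≤ (s - 2) / 2`
    -- for `s ≥ 3`.
    by_cases hb : x ≤ 1 / 2
    · rw [if_pos (h1 (by linarith)), if_pos (h2 (by linarith)), if_pos (h3 (by linarith))]
      omega
    by_cases hc : x < (s - 1) / 2
    · rw [if_pos (h1 (by linarith)), if_pos (h3 (by linarith)),
        if_pos (h4 (Or.inl (by linarith)))]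
      omega
    · rw [if_pos (h3 (by linarith)), if_pos (h4 (Or.inl (by linarith))),
        if_pos (Or.inr (by linarith))]
      omega
  · simp only [hs, if_false]
    rw [if_pos (h1 (by linarith)), if_pos (h3 (by linarith))]
    by_cases ha : x < (4 - s) / 2
    · rw [if_pos (h2 (by linarith)), if_pos (Or.inl (by linarith))]
      omega
    by_cases hb : x < (s - 2) / 2
    · rw [if_pos (h2 (by linarith)), if_pos (h4 (Or.inr ⟨by linarith, by linarith⟩))]
      omega
    · rw [if_pos (h4 (Or.inr ⟨by linarith, by linarith⟩)), if_pos (Or.inr (by linarith))]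
      omega

/-! ### Filled periods and trimming -/

/-- The index of the first period that begins after the beginning of the window. -/
def firstPeriod {V : Type*} (α δ : ℝ) (p : Request V) : ℤ := ⌊(p.start - δ) / α⌋ + 1

/-- The index of the last period that begins before or at the end of the window. -/
def lastPeriod {V : Type*} (α δ : ℝ) (p : Request V) : ℤ := ⌊(p.start + p.len - δ) / α⌋

theorem fills_iff {V : Type*} {α : ℝ} (hα : 0 < α) (δ : ℝ) (p : Request V) (k : ℤ) :
    Fills α δ p k ↔ firstPeriod α δ p ≤ k ∧ k < lastPeriod α δ p := by
  unfold Fills firstPeriod lastPeriod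
  rw [Int.add_one_le_iff, Int.floor_lt, div_lt_iff₀ hα, ← Int.add_one_le_iff, Int.le_floor,
    le_div_iff₀ hα]
  push_cast
  constructor <;> rintro ⟨h1, h2⟩ <;> constructor <;> linarith

theorem setOf_fills {V : Type*} {α : ℝ} (hα : 0 < α) (δ : ℝ) (p : Request V) :
    {k : ℤ | Fills α δ p k} = Set.Ico (firstPeriod α δ p) (lastPeriod α δ p) := by
  ext k
  exact fills_iff hα δ p k

theorem mem_WSet_iff {V : Type*} {n : ℕ} (I : Fin n → Request V) {α : ℝ} (hα : 0 < α) (δ : ℝ)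
    (l : ℕ) (p : Fin n) : p ∈ WSet I α δ l ↔
      (lastPeriod α δ (I p) - firstPeriod α δ (I p)).toNat = l := by
  change {k : ℤ | Fills α δ (I p) k}.encard = l ↔ _
  rw [setOf_fills hα, ← Finset.coe_Ico, Set.encard_coe_eq_coe_finsetCard, Int.card_Ico]
  norm_cast

theorem trim_val {V : Type*} (α δ : ℝ) (j k : ℤ) (p : Request V) :
    (trim α δ j k p).val =
      if lastPeriod α δ p - firstPeriod α δ p = 1 then some (firstPeriod α δ p)
      else if lastPeriod α δ p - firstPeriod α δ p = 2 then some (firstPeriod α δ p - 1 + j)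
      else if lastPeriod α δ p - firstPeriod α δ p = 3 then some (firstPeriod α δ p - 1 + k)
      else none := by
  have : (trim α δ j k p).val =
      if decide (lastPeriod α δ p - firstPeriod α δ p = 1) then some (firstPeriod α δ p)
      else if decide (lastPeriod α δ p - firstPeriod α δ p = 2) then
        some (firstPeriod α δ p - 1 + j)
      else if decide (lastPeriod α δ p - firstPeriod α δ p = 3) then
        some (firstPeriod α δ p - 1 + k)
      else none := rfl
  simpa only [decide_eq_true_eq] using this

theorem trim_cost {V : Type*} (α δ : ℝ) (j k : ℤ) (p : Request V) :
    (trim α δ j k p).cost = 15 := rfl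

theorem fills_of_trim {V : Type*} {α : ℝ} (hα : 0 < α) {δ : ℝ} {j k : ℤ} (hj : 1 ≤ j ∧ j ≤ 2)
    (hk : 1 ≤ k ∧ k ≤ 3) {p : Request V} {m : ℤ} (h : (trim α δ j k p).val = some m) :
    Fills α δ p m := by
  rw [fills_iff hα]
  rw [trim_val] at h
  split_ifs at h <;> simp only [Option.some.injEq] at h <;> omega

/-- The instance with trimmed windows that SPEEDUP passes on. -/
def trimmed {V : Type*} {n : ℕ} (I : Fin n → Request V) (s α δ : ℝ) (j k : ℤ) :
    TrimmedInstance V n :=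
  ⟨s, α, δ, fun p => (I p).loc, fun p => (trim α δ j k (I p)).val⟩

/-- This makes every run found on trimmed windows a run of the original instance. -/
theorem trimmed_window_subset {V : Type*} {n : ℕ} (I : Fin n → Request V) (s : ℝ) {α : ℝ}
    (hα : 0 < α) (δ : ℝ) {j k : ℤ} (hj : 1 ≤ j ∧ j ≤ 2) (hk : 1 ≤ k ∧ k ≤ 3) (p : Fin n) :
    (trimmed I s α δ j k).window p ⊆ (I p).window := by
  rintro t ⟨m, hm, h⟩
  have hm' : (trim α δ j k (I p)).val = some m := hm
  obtain ⟨h0, h1⟩ : δ + m * α ≤ t ∧ t < δ + (m + 1) * α := h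
  obtain ⟨h2, h3⟩ := fills_of_trim hα hj hk hm'
  exact ⟨h2.le.trans h0, h1.trans_le h3⟩

theorem IsServiceRun.mono {V : Type*} [MetricSpace V] {n : ℕ} {loc : Fin n → V}
    {window window' : Fin n → Set ℝ} {s : ℝ} {R : Run n} (h : IsServiceRun loc window s R)
    (hw : ∀ p, window p ⊆ window' p) : IsServiceRun loc window' s R :=
  ⟨h.1, fun x hx => hw _ (h.2.1 x hx), h.2.2⟩

/-! ### Averaging over equidistant starting points -/

/-- Points with distinct remainders modulo `1/2` among the multiples of `1 / (2 N)` lie sparsely. -/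
theorem card_le_ceil {N : ℕ} (hN : 0 < N) {S : Finset ℕ} (hS : S ⊆ Finset.range N) (f : ℕ → ℤ)
    (a z : ℝ) (h : ∀ d ∈ S, a < d / (2 * N) + f d * (1 / 2) ∧
      (d : ℝ) / (2 * N) + f d * (1 / 2) ≤ a + z) : S.card ≤ ⌈2 * N * z⌉₊ := by
  have hN' : (0 : ℝ) < N := by exact_mod_cast hN
  obtain ⟨lo, hlo⟩ : ∃ lo, lo = ⌊2 * (N : ℝ) * a⌋ := ⟨_, rfl⟩
  obtain ⟨hi, hhi⟩ : ∃ hi, hi = ⌊2 * (N : ℝ) * (a + z)⌋ := ⟨_, rfl⟩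
  -- Measured in units of `1 / (2 N)`, the points are the integers `d + N f d`, distinct because
  -- they have distinct residues `d` modulo `N`.
  have hmaps : Set.MapsTo (fun d : ℕ => (d : ℤ) + N * f d) S (Finset.Ioc lo hi) := by
    intro d hd
    obtain ⟨h1, h2⟩ := h d hd
    have e : (((d : ℤ) + N * f d : ℤ) : ℝ) = 2 * N * ((d : ℝ) / (2 * N) + f d * (1 / 2)) := by
      push_cast
      field_simp
    rw [Finset.mem_coe, Finset.mem_Ioc, hlo, hhi, Int.floor_lt, Int.le_floor, e]
    exact ⟨by gcongr, by gcongr⟩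
  have hinj : Set.InjOn (fun d : ℕ => (d : ℤ) + N * f d) S := by
    intro d hd d' hd' e
    have h1 := Finset.mem_range.mp (hS hd)
    have h2 := Finset.mem_range.mp (hS hd')
    have e' : ((d : ℤ) + N * f d) % N = ((d' : ℤ) + N * f d') % N := congrArg (· % (N : ℤ)) e
    rw [Int.add_mul_emod_self_left, Int.add_mul_emod_self_left,
      Int.emod_eq_of_lt (by omega) (by omega), Int.emod_eq_of_lt (by omega) (by omega)] at e'
    exact_mod_cast e'
  refine (Finset.card_le_card_of_injOn _ hmaps hinj).trans ?_
  have h1 : hi < lo + ⌈2 * (N : ℝ) * z⌉ + 1 := by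
    rw [hhi, Int.floor_lt, hlo]
    push_cast
    have := Int.lt_floor_add_one (2 * (N : ℝ) * a)
    have := Int.le_ceil (2 * (N : ℝ) * z)
    rw [mul_add]
    linarith
  rw [Int.card_Ioc, ← Int.ceil_toNat]
  omega

/-- A request in `W_2` is serviced near an end of the range of positions relative to its trimmed
window for few sets of periods only. -/
theorem card_margin_le {V : Type*} (p : Request V) {s τ : ℝ} (hs3 : 3 ≤ s) {N : ℕ}
    (hN : 0 < N) (hτ : τ ∈ p.window) (hp : ∀ d < N, lastPeriod (1 / 2) (d / (2 * N)) p =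
      firstPeriod (1 / 2) (d / (2 * N)) p + 2) (x : ℕ → ℝ)
    (hx : ∀ d, x d = τ - ((d : ℝ) / (2 * N) + firstPeriod (1 / 2) (d / (2 * N)) p * (1 / 2))) :
    (∀ d < N, -(1 / 2) ≤ x d ∧ x d < 3 / 2) ∧
    ((Finset.range N).filter fun d => x d < -(1 / 2) + margin s ∨ 3 / 2 - margin s ≤ x d).card ≤
      ⌈2 * N * margin s⌉₊ := by
  have hz : margin s ≤ 1 / 2 := by unfold margin; split_ifs <;> linarith
  set T : ℕ → ℝ := fun d => (d : ℝ) / (2 * N) + firstPeriod (1 / 2) (d / (2 * N)) p * (1 / 2)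
    with hT
  have hxT : ∀ d, x d = τ - T d := hx
  have hT' : ∀ d < N, p.start < T d ∧ T d ≤ p.start + 1 / 2 ∧ T d + 1 ≤ p.start + p.len ∧
      p.start + p.len < T d + 3 / 2 := by
    intro d hd
    have h1 := Int.floor_le ((p.start - d / (2 * N)) / (1 / 2))
    have h2 := Int.lt_floor_add_one ((p.start - d / (2 * N)) / (1 / 2))
    have h3 := Int.floor_le ((p.start + p.len - d / (2 * N)) / (1 / 2))
    have h4 := Int.lt_floor_add_one ((p.start + p.len - d / (2 * N)) / (1 / 2))
    have e := hp d hd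
    simp only [hT, firstPeriod, lastPeriod] at e ⊢
    rw [e] at h3 h4
    push_cast at h3 h4 ⊢
    refine ⟨by linarith, by linarith, by linarith, by linarith⟩
  obtain ⟨hτ0, hτ1⟩ := hτ
  refine ⟨fun d hd => ?_, ?_⟩
  · obtain ⟨h1, h2, h3, h4⟩ := hT' d hd
    rw [hxT]
    exact ⟨by linarith, by linarith⟩
  -- Only one end piece can occur: points in both would put two values of `T` more than `2 - 2 *
  -- margin s ≥ 1` apart, while all of them lie in a half-open interval of length 1/2. In either
  -- case `T` is confined to an interval of length `margin s`.
  by_cases hlow : ∃ d < N, x d < -(1 / 2) + margin s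
  · obtain ⟨d₀, hd₀, hx₀⟩ := hlow
    refine card_le_ceil hN (Finset.filter_subset _ _)
      (fun d => firstPeriod (1 / 2) (d / (2 * N)) p) (τ + 1 / 2 - margin s) _ ?_
    intro d hd
    obtain ⟨hd, hb⟩ := Finset.mem_filter.mp hd
    rw [Finset.mem_range] at hd
    change τ + 1 / 2 - margin s < T d ∧ T d ≤ _
    obtain ⟨h1, h2, h3, h4⟩ := hT' d hd
    obtain ⟨h1', h2', h3', h4'⟩ := hT' d₀ hd₀
    rw [hxT] at hb hx₀
    rcases hb with hb | hb
    · exact ⟨by linarith, by linarith⟩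
    · linarith
  · push Not at hlow
    refine card_le_ceil hN (Finset.filter_subset _ _)
      (fun d => firstPeriod (1 / 2) (d / (2 * N)) p) (τ - 3 / 2) _ ?_
    intro d hd
    obtain ⟨hd, hb⟩ := Finset.mem_filter.mp hd
    rw [Finset.mem_range] at hd
    change τ - 3 / 2 < T d ∧ T d ≤ _
    obtain ⟨h1, h2, h3, h4⟩ := hT' d hd
    have hb := hb.resolve_left (not_lt.mpr (hlow d hd))
    rw [hxT] at hb
    exact ⟨by linarith, by linarith⟩

/-- For one of `N` equidistant sets of periods, a run at speed `s` on the trimmed windows achieves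
nearly the fraction `(s - 1) / 4` of the profit of a unit-speed run on windows in `W_2`. -/
theorem exists_trimmed_run {V : Type*} [MetricSpace V] {n : ℕ} (I : Fin n → Request V) {s : ℝ}
    (hs3 : 3 ≤ s) (hs5 : s ≤ 5) {N : ℕ} (hN : 0 < N) {R : Run n} (hR : IsRunOf I 1 R)
    (S : Finset (Fin n)) (hS : ∀ p ∈ S, ∃ t, (p, t) ∈ R)
    (hW : ∀ p ∈ S, ∀ d < N, p ∈ WSet I (1 / 2) ((d : ℝ) / (2 * N)) 2) :
    ∃ d < N, ∃ R' : Run n,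
      IsServiceRun (fun p => (I p).loc) (trimmed I s (1 / 2) ((d : ℝ) / (2 * N)) 1 1).window s R' ∧
      S.card * (N * multiplicity s) ≤ 4 * N * profit R' + S.card * ⌈2 * N * margin s⌉₊ := by
  classical
  have hτ : ∀ p : Fin n, ∃ t, p ∈ S → (p, t) ∈ R := by
    intro p
    by_cases hp : p ∈ S
    · obtain ⟨t, h⟩ := hS p hp
      exact ⟨t, fun _ => h⟩
    · exact ⟨0, fun h => absurd h hp⟩
  choose τ hτ using hτ
  let δ : ℕ → ℝ := fun d => (d : ℝ) / (2 * N)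
  let f : ℕ → Fin n → ℤ := fun d p => firstPeriod (1 / 2) (δ d) (I p)
  let x : Fin n → ℕ → ℝ := fun p d => τ p - (δ d + f d p * (1 / 2))
  let A : ℕ → Bool × Bool → Finset (Fin n) := fun d c =>
    S.filter fun p => Reaches s (δ d) (f d p) (x p d) c.1 c.2
  have hcount : ∀ p ∈ S, ∀ d < N,
      lastPeriod (1 / 2) (δ d) (I p) = firstPeriod (1 / 2) (δ d) (I p) + 2 := by
    intro p hp d hd
    have := (mem_WSet_iff I (by norm_num) _ _ p).mp (hW p hp d hd)
    change (lastPeriod (1 / 2) (δ d) (I p) - firstPeriod (1 / 2) (δ d) (I p)).toNat = 2 at this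
    omega
  have hrun : ∀ d < N, ∀ c, ∃ R' : Run n,
      IsServiceRun (fun p => (I p).loc) (trimmed I s (1 / 2) (δ d) 1 1).window s R' ∧
      profit R' = (A d c).card := by
    intro d hd c
    refine exists_run_of_position hR
      (fun t t' h => abs_position_sub_le (by linarith) (δ d) c.1 c.2 h) (A d c) ?_
    intro p hp
    obtain ⟨hp, t, ht, e⟩ := Finset.mem_filter.mp hp
    refine ⟨t, ⟨f d p, ?_, ht⟩, ?_⟩
    · change (trim (1 / 2) (δ d) 1 1 (I p)).val = some (f d p)
      rw [trim_val, if_neg (by rw [hcount p hp d hd]; omega),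
        if_pos (by rw [hcount p hp d hd]; omega)]
      simp [f]
    · rw [e, add_sub_cancel]
      exact hτ p hp
  have hsum : S.card * (N * multiplicity s) ≤
      ∑ y ∈ Finset.range N ×ˢ (Finset.univ : Finset (Bool × Bool)), (A y.1 y.2).card +
        S.card * ⌈2 * N * margin s⌉₊ := by
    have h1 : ∀ p ∈ S, N * multiplicity s ≤
        ∑ d ∈ Finset.range N, (Finset.univ.filter fun c : Bool × Bool =>
          Reaches s (δ d) (f d p) (x p d) c.1 c.2).card + ⌈2 * N * margin s⌉₊ := by
      intro p hp
      obtain ⟨hx, hm⟩ := card_margin_le (I p) hs3 hN (hR.2.1 _ (hτ p hp)) (hcount p hp) (x p)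
        (fun d => rfl)
      have h2 : ∀ d ∈ Finset.range N, multiplicity s ≤ (Finset.univ.filter fun c : Bool × Bool =>
          Reaches s (δ d) (f d p) (x p d) c.1 c.2).card +
          if x p d < -(1 / 2) + margin s ∨ 3 / 2 - margin s ≤ x p d then 1 else 0 := by
        intro d hd
        obtain ⟨h3, h4⟩ := hx d (Finset.mem_range.mp hd)
        exact multiplicity_le_card_reaches hs3 hs5 (δ d) (f d p) h3 h4
      have h5 := Finset.sum_le_sum h2
      rw [Finset.sum_add_distrib, ← Finset.card_filter, Finset.sum_const, Finset.card_range,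
        smul_eq_mul] at h5
      omega
    have h6 := Finset.sum_le_sum h1
    rw [Finset.sum_add_distrib, Finset.sum_const, Finset.sum_const, smul_eq_mul, smul_eq_mul]
      at h6
    refine h6.trans (le_of_eq ?_)
    congr 1
    rw [Finset.sum_product, Finset.sum_comm]
    refine Finset.sum_congr rfl fun d _ => ?_
    simp only [A, Finset.card_filter]
    rw [Finset.sum_comm]
  -- Pigeonhole: the best of the `4 N` pairs of a starting point and a zigzag is at least the
  -- average.
  obtain ⟨y, hy, hmax⟩ := Finset.exists_max_image
    (Finset.range N ×ˢ (Finset.univ : Finset (Bool × Bool))) (fun y => (A y.1 y.2).card)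
    ⟨(0, true, true), by simp [hN]⟩
  have hyN : y.1 < N := by simpa using hy
  obtain ⟨R', hR', e⟩ := hrun y.1 hyN y.2
  refine ⟨y.1, hyN, R', hR', hsum.trans ?_⟩
  have := Finset.sum_le_card_nsmul _ _ _ hmax
  simp only [Finset.card_product, Finset.card_range, Finset.card_univ, Fintype.card_prod,
    Fintype.card_bool, smul_eq_mul] at this
  rw [e]
  linarith

/-! ### Remainders represent all sets of periods -/

/-- The times at which the window of `p` begins or ends, for some request `p` of the instance. -/
def IsEndpoint {V : Type*} {n : ℕ} (I : Fin n → Request V) (x : ℝ) : Prop :=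
  ∃ p, x = (I p).start ∨ x = (I p).start + (I p).len

theorem remainder_val (α x : ℝ) : (remainder α x).val = x - ⌊x / α⌋ * α := rfl

theorem remainder_cost (α x : ℝ) : (remainder α x).cost = 4 := rfl

theorem floor_sub_div_eq_iff {α : ℝ} (hα : 0 < α) (x δ : ℝ) (k : ℤ) :
    ⌊(x - δ) / α⌋ = k ↔ δ ≤ x - k * α ∧ x - k * α < δ + α := by
  rw [Int.floor_eq_iff, le_div_iff₀ hα, div_lt_iff₀ hα]
  constructor <;> rintro ⟨h1, h2⟩ <;> constructor <;> linarith

theorem remainder_mem_Ico {α : ℝ} (hα : 0 < α) (x : ℝ) :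
    (remainder α x).val ∈ Set.Ico 0 α := by
  have := (floor_sub_div_eq_iff hα x 0 ⌊x / α⌋).mp (by rw [sub_zero])
  rw [zero_add] at this
  exact this

theorem remainder_add_int_mul {α : ℝ} (hα : 0 < α) (x : ℝ) (k : ℤ) :
    (remainder α (x + k * α)).val = (remainder α x).val := by
  rw [remainder_val, remainder_val, add_div, mul_div_cancel_right₀ _ hα.ne', Int.floor_add_intCast]
  push_cast
  ring

/-- The set of periods with any starting point `δ₀` is the same, up to a shift of the indices, as
that starting at the remainder of some end point of a window. -/
theorem exists_remainder_floor {V : Type*} {n : ℕ} (hn : 0 < n) (I : Fin n → Request V) {α : ℝ}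
    (hα : 0 < α) (δ₀ : ℝ) : ∃ x₀, IsEndpoint I x₀ ∧ ∃ c : ℤ, ∀ x, IsEndpoint I x →
      ⌊(x - (remainder α x₀).val) / α⌋ = ⌊(x - δ₀) / α⌋ - c := by
  have hfin : {x | IsEndpoint I x}.Finite := by
    refine ((Set.finite_range fun p => (I p).start).union
      (Set.finite_range fun p => (I p).start + (I p).len)).subset ?_
    rintro x ⟨p, rfl | rfl⟩
    · exact Or.inl ⟨p, rfl⟩
    · exact Or.inr ⟨p, rfl⟩
  -- Move the divisions forward from `δ₀` until one first meets an end point `x₀`; no end point is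
  -- crossed. The new starting point differs from the remainder of `x₀` by a multiple of `α`, which
  -- `c` records.
  obtain ⟨x₀, hx₀, hmin⟩ := hfin.exists_minimalFor (fun x => x - ⌊(x - δ₀) / α⌋ * α) _
    ⟨(I ⟨0, hn⟩).start, ⟨0, hn⟩, Or.inl rfl⟩
  refine ⟨x₀, hx₀, ⌊(x₀ - δ₀) / α⌋ - ⌊x₀ / α⌋, fun x hx => ?_⟩
  have hle : x₀ - ⌊(x₀ - δ₀) / α⌋ * α ≤ x - ⌊(x - δ₀) / α⌋ * α := by
    rcases le_total (x₀ - ⌊(x₀ - δ₀) / α⌋ * α) (x - ⌊(x - δ₀) / α⌋ * α) with h | h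
    · exact h
    · exact hmin hx h
  have h1 := (floor_sub_div_eq_iff hα x δ₀ _).mp rfl
  have h2 := (floor_sub_div_eq_iff hα x₀ δ₀ _).mp rfl
  rw [floor_sub_div_eq_iff hα, remainder_val]
  push_cast
  constructor <;> nlinarith [h1.1, h1.2, h2.1, h2.2]

theorem IsServiceRun.shift {V : Type*} [MetricSpace V] {n : ℕ} {loc : Fin n → V}
    {window window' : Fin n → Set ℝ} {s : ℝ} {R : Run n} (h : IsServiceRun loc window s R) (Δ : ℝ)
    (hw : ∀ p, ∀ t ∈ window p, t + Δ ∈ window' p) :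
    IsServiceRun loc window' s (R.map fun x => (x.1, x.2 + Δ)) := by
  refine ⟨?_, ?_, ?_⟩
  · simpa [Function.comp_def] using h.1
  · intro x hx
    obtain ⟨y, hy, rfl⟩ := List.mem_map.mp hx
    exact hw _ _ (h.2.1 y hy)
  · rw [List.isChain_map]
    refine h.2.2.imp fun a b hab => ?_
    simpa using hab

/-- For any set of periods there is one, starting at the remainder of an end point of a window, that
is as good for runs on trimmed windows. -/
theorem exists_remainder_run {V : Type*} [MetricSpace V] {n : ℕ} (hn : 0 < n)
    (I : Fin n → Request V) (s : ℝ) {α : ℝ} (hα : 0 < α) (δ₀ : ℝ) (j k : ℤ) {R : Run n}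
    (hR : IsServiceRun (fun p => (I p).loc) (trimmed I s α δ₀ j k).window s R) :
    ∃ x₀, IsEndpoint I x₀ ∧ ∃ R' : Run n, IsServiceRun (fun p => (I p).loc)
      (trimmed I s α (remainder α x₀).val j k).window s R' ∧ profit R' = profit R := by
  obtain ⟨x₀, hx₀, c, hc⟩ := exists_remainder_floor hn I hα δ₀
  set δ := (remainder α x₀).val
  have hslot : ∀ p, (trim α δ j k (I p)).val = (trim α δ₀ j k (I p)).val.map (· - c) := by
    intro p
    have h1 : firstPeriod α δ (I p) = firstPeriod α δ₀ (I p) - c := by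
      rw [firstPeriod, firstPeriod, hc _ ⟨p, Or.inl rfl⟩]
      ring
    have h2 : lastPeriod α δ (I p) = lastPeriod α δ₀ (I p) - c := hc _ ⟨p, Or.inr rfl⟩
    rw [trim_val, trim_val, h1, h2, sub_sub_sub_cancel_right]
    split_ifs <;> simp <;> ring
  refine ⟨x₀, hx₀, _, hR.shift (δ - c * α - δ₀) ?_, by simp [profit]⟩
  rintro p t ⟨m, hm, ht⟩
  have hm' : (trim α δ₀ j k (I p)).val = some m := hm
  obtain ⟨h0, h1⟩ : δ₀ + m * α ≤ t ∧ t < δ₀ + (m + 1) * α := ht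
  refine ⟨m - c, ?_, ?_⟩
  · change (trim α δ j k (I p)).val = some (m - c)
    rw [hslot, hm']
    rfl
  · change δ + ((m - c : ℤ) : ℝ) * α ≤ _ ∧ _ < δ + (((m - c : ℤ) : ℝ) + 1) * α
    push_cast
    constructor <;> nlinarith

/-- The remainders of the end points of the windows. -/
def remainders {V : Type*} {n : ℕ} (I : Fin n → Request V) (α : ℝ) : Finset ℝ :=
  open Classical in
  (Finset.univ.image fun p => (remainder α (I p).start).val) ∪
    Finset.univ.image fun p => (remainder α ((I p).start + (I p).len)).val

theorem mem_remainders {V : Type*} {n : ℕ} {I : Fin n → Request V} {α y : ℝ} :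
    y ∈ remainders I α ↔ ∃ x, IsEndpoint I x ∧ y = (remainder α x).val := by
  classical
  simp only [remainders, Finset.mem_union, Finset.mem_image, Finset.mem_univ, true_and]
  constructor
  · rintro (⟨p, rfl⟩ | ⟨p, rfl⟩)
    · exact ⟨_, ⟨p, Or.inl rfl⟩, rfl⟩
    · exact ⟨_, ⟨p, Or.inr rfl⟩, rfl⟩
  · rintro ⟨x, ⟨p, rfl | rfl⟩, rfl⟩
    · exact Or.inl ⟨p, rfl⟩
    · exact Or.inr ⟨p, rfl⟩

/-- As 3 is a multiple of both 1/2 and `α`, the remainder modulo `α` is determined by that modulo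
1/2 and the index of the half-unit period modulo 6. -/
theorem card_remainders_le {V : Type*} {n : ℕ} (I : Fin n → Request V) {α : ℝ} (hα : 0 < α)
    {q : ℤ} (hq : q * α = 3) : (remainders I α).card ≤ 6 * (remainders I (1 / 2)).card := by
  classical
  have hsub : remainders I α ⊆ (remainders I (1 / 2) ×ˢ Finset.range 6).image
      fun y => (remainder α (y.1 + y.2 * (1 / 2))).val := by
    intro y hy
    obtain ⟨x, hx, rfl⟩ := mem_remainders.mp hy
    refine Finset.mem_image.mpr ⟨((remainder (1 / 2) x).val, (⌊x / (1 / 2)⌋ % 6).toNat),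
      Finset.mem_product.mpr ⟨mem_remainders.mpr ⟨x, hx, rfl⟩, ?_⟩, ?_⟩
    · rw [Finset.mem_range]
      omega
    · set m := ⌊x / (1 / 2)⌋ with hm
      rw [← remainder_add_int_mul hα _ (m / 6 * q)]
      congr 2
      have h1 : (((m % 6).toNat : ℤ) : ℝ) = ((m - 6 * (m / 6) : ℤ) : ℝ) := by
        congr 1
        omega
      push_cast at h1
      push_cast
      rw [h1, mul_assoc, hq, remainder_val, ← hm]
      ring
  refine (Finset.card_le_card hsub).trans (Finset.card_image_le.trans ?_)
  rw [Finset.card_product, Finset.card_range, mul_comm]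

/-- Starting at the remainder of `x` puts a division exactly on `x`; a larger starting point in the
range moves it past `x` and so changes the first or last index filled by the window ending or
beginning there. -/
theorem card_remainders_le_numPeriodSets {V : Type*} {n : ℕ} (I : Fin n → Request V)
    (hI : ∀ p, 1 ≤ (I p).len) :
    ((remainders I (1 / 2)).card : ℕ∞) ≤ numPeriodSets I (1 / 2) := by
  have hα : (0 : ℝ) < 1 / 2 := by norm_num
  -- Length at least 1 forces a filled period. Thus the sets of indices are nonempty intervals and
  -- determine their ends.
  have hlen : ∀ δ p, firstPeriod (1 / 2) δ (I p) < lastPeriod (1 / 2) δ (I p) := by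
    intro δ p
    have h : ⌊((I p).start - δ) / (1 / 2)⌋ + 2 ≤ lastPeriod (1 / 2) δ (I p) := by
      rw [lastPeriod, Int.le_floor]
      push_cast
      have := Int.floor_le (((I p).start - δ) / (1 / 2))
      have := hI p
      linarith
    rw [firstPeriod]
    omega
  have hinj : Set.InjOn (fun (δ : ℝ) (p : Fin n) => {k : ℤ | Fills (1 / 2) δ (I p) k})
      (remainders I (1 / 2)) := by
    have key : ∀ ρ ∈ remainders I (1 / 2), ∀ ρ', ρ < ρ' →
        (fun p : Fin n => {k : ℤ | Fills (1 / 2) ρ (I p) k}) ≠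
        (fun p : Fin n => {k : ℤ | Fills (1 / 2) ρ' (I p) k}) := by
      intro ρ hρ ρ' hlt e
      obtain ⟨x, ⟨p, hx⟩, hρx⟩ := mem_remainders.mp hρ
      have e' := congrFun e p
      simp only [setOf_fills hα] at e'
      have h1 := hlen ρ p
      have h2 := hlen ρ' p
      have m1 := Set.ext_iff.mp e' (firstPeriod (1 / 2) ρ (I p))
      have m2 := Set.ext_iff.mp e' (firstPeriod (1 / 2) ρ' (I p))
      have m3 := Set.ext_iff.mp e' (lastPeriod (1 / 2) ρ (I p) - 1)
      have m4 := Set.ext_iff.mp e' (lastPeriod (1 / 2) ρ' (I p) - 1)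
      simp only [Set.mem_Ico] at m1 m2 m3 m4
      have h3 : firstPeriod (1 / 2) ρ (I p) = firstPeriod (1 / 2) ρ' (I p) := by omega
      have h4 : lastPeriod (1 / 2) ρ (I p) = lastPeriod (1 / 2) ρ' (I p) := by omega
      have h5 : ⌊(x - ρ) / (1 / 2)⌋ = ⌊(x - ρ') / (1 / 2)⌋ := by
        rcases hx with rfl | rfl
        · simp only [firstPeriod] at h3
          omega
        · exact h4
      have h6 : ⌊(x - ρ) / (1 / 2)⌋ = ⌊x / (1 / 2)⌋ := by
        rw [floor_sub_div_eq_iff hα, hρx, remainder_val]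
        constructor <;> linarith
      rw [h6] at h5
      have h7 := (floor_sub_div_eq_iff hα x ρ' _).mp h5.symm
      rw [hρx, remainder_val] at hlt
      linarith [h7.1]
    intro ρ hρ ρ' hρ' e
    rcases lt_trichotomy ρ ρ' with h | h | h
    · exact absurd e (key ρ hρ ρ' h)
    · exact h
    · exact absurd e.symm (key ρ' hρ' ρ h)
  rw [← Set.encard_coe_eq_coe_finsetCard, ← hinj.encard_image]
  refine Set.encard_le_encard (Set.image_mono ?_)
  intro ρ hρ
  obtain ⟨x, -, rfl⟩ := mem_remainders.mp hρ
  exact remainder_mem_Ico hα x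

/-! ### Results and costs of the list routines -/

theorem Timed.bind_val {α β : Type} (x : Timed α) (f : α → Timed β) :
    (x >>= f).val = (f x.val).val := rfl

theorem Timed.bind_cost {α β : Type} (x : Timed α) (f : α → Timed β) :
    (x >>= f).cost = x.cost + (f x.val).cost := rfl

theorem Timed.pure_val {α : Type} (a : α) : (pure a : Timed α).val = a := rfl

theorem Timed.pure_cost {α : Type} (a : α) : (pure a : Timed α).cost = 0 := rfl

theorem endpoints_cost {V : Type*} (l : List (Request V)) :
    (endpoints l).cost = 3 * l.length + 1 := by
  induction l with
  | nil => rfl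
  | cons p l ih =>
    simp only [endpoints, Timed.bind_cost, Timed.add, Timed.cons, ih, List.length_cons]
    ring

theorem endpoints_length {V : Type*} (l : List (Request V)) :
    (endpoints l).val.length = 2 * l.length := by
  induction l with
  | nil => rfl
  | cons p l ih =>
    simp only [endpoints, Timed.bind_val, Timed.add, Timed.cons, List.length_cons, ih]
    ring

theorem mem_endpoints {V : Type*} (l : List (Request V)) (x : ℝ) :
    x ∈ (endpoints l).val ↔ ∃ p ∈ l, x = p.start ∨ x = p.start + p.len := by
  induction l with
  | nil => simp [endpoints]
  | cons p l ih =>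
    simp only [endpoints, Timed.bind_val, Timed.add, Timed.cons, List.mem_cons, ih,
      exists_eq_or_imp, or_assoc]

theorem mem_endpoints_ofFn {V : Type*} {n : ℕ} (I : Fin n → Request V) (x : ℝ) :
    x ∈ (endpoints (List.ofFn I)).val ↔ IsEndpoint I x := by
  simp [mem_endpoints, IsEndpoint, List.mem_ofFn]

theorem member_spec (x : ℝ) (l : List ℝ) :
    ((member x l).val = true ↔ x ∈ l) ∧ (member x l).cost ≤ 2 * l.length + 1 := by
  induction l with
  | nil => simp [member]
  | cons y l ih =>
    by_cases h : x = y
    · simp [member, Timed.bind_val, Timed.bind_cost, Timed.eq, h, Timed.pure_val, Timed.pure_cost]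
    · simp only [member, Timed.bind_val, Timed.bind_cost, Timed.eq, h, decide_false,
        Bool.false_eq_true, if_false, List.mem_cons, false_or, List.length_cons]
      exact ⟨ih.1, by omega⟩

theorem shifts_spec (σ h : ℝ) (r : ℕ) : (shifts σ h r).val.length = r ∧
    (shifts σ h r).cost = 3 * r + 1 ∧ ∀ d < r, σ + d * h ∈ (shifts σ h r).val := by
  induction r with
  | zero => simp [shifts]
  | succ r ih =>
    obtain ⟨h1, h2, h3⟩ := ih
    refine ⟨?_, ?_, fun d hd => ?_⟩
    · simp [shifts, Timed.bind_val, Timed.mul, Timed.add, Timed.cons, h1]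
    · simp only [shifts, Timed.bind_cost, Timed.mul, Timed.add, Timed.cons, h2]
      ring
    · simp only [shifts, Timed.bind_val, Timed.mul, Timed.add, Timed.cons, List.mem_cons]
      rcases Nat.lt_succ_iff_lt_or_eq.mp hd with hd | rfl
      · exact Or.inr (h3 d hd)
      · exact Or.inl rfl

/-- `collect` either finds all remainders, or there are at least `r` of them. -/
theorem collect_spec (α : ℝ) (r : ℕ∞) (E : Finset ℝ) (B : ℕ)
    (hB : ∀ c : ℕ, (c : ℕ∞) ≤ r → c ≤ E.card → c ≤ B) (l acc : List ℝ)
    (hl : ∀ x ∈ l, (remainder α x).val ∈ E) (hacc : ∀ y ∈ acc, y ∈ E) (hnd : acc.Nodup)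
    (hr : (acc.length : ℕ∞) < r) :
    (collect α r acc acc.length l).cost ≤ 1 + l.length * (2 * B + 8) ∧
    (∀ l', (collect α r acc acc.length l).val = some l' →
      l'.length ≤ B ∧ acc ⊆ l' ∧ ∀ x ∈ l, (remainder α x).val ∈ l') ∧
    ((collect α r acc acc.length l).val = none → ∃ r' : ℕ, r = r' ∧ r' ≤ B) := by
  classical
  have hcard : ∀ acc : List ℝ, (∀ y ∈ acc, y ∈ E) → acc.Nodup → acc.length ≤ E.card := by
    intro acc h hnd
    rw [← List.toFinset_card_of_nodup hnd]
    exact Finset.card_le_card fun y hy => h y (List.mem_toFinset.mp hy)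
  induction l generalizing acc with
  | nil =>
    refine ⟨by simp [collect], ?_, by simp [collect]⟩
    intro l' h
    obtain rfl : acc = l' := by simpa [collect] using h
    exact ⟨hB _ hr.le (hcard _ hacc hnd), fun _ h => h, by simp⟩
  | cons x l ih =>
    have hlen : acc.length ≤ B := hB _ hr.le (hcard _ hacc hnd)
    obtain ⟨hm, hmc⟩ := member_spec (remainder α x).val acc
    have hl' : ∀ x ∈ l, (remainder α x).val ∈ E := fun y hy => hl y (List.mem_cons_of_mem _ hy)
    simp only [collect, Timed.bind_val, Timed.bind_cost, remainder_cost, List.length_cons]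
    by_cases h : (remainder α x).val ∈ acc
    · obtain ⟨i1, i2, i3⟩ := ih acc hl' hacc hnd hr
      rw [if_pos (hm.mpr h)]
      refine ⟨by linarith, fun l' e => ?_, i3⟩
      obtain ⟨j1, j2, j3⟩ := i2 l' e
      exact ⟨j1, j2, List.forall_mem_cons.mpr ⟨j2 h, j3⟩⟩
    · rw [if_neg (fun h' => h (hm.mp h'))]
      have hacc' : ∀ y ∈ (remainder α x).val :: acc, y ∈ E :=
        List.forall_mem_cons.mpr ⟨hl x List.mem_cons_self, hacc⟩
      have hnd' : ((remainder α x).val :: acc).Nodup := List.nodup_cons.mpr ⟨h, hnd⟩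
      simp only [Timed.bind_val, Timed.bind_cost, Timed.succ, Timed.countLt, decide_eq_true_eq]
      by_cases hc : ((acc.length + 1 : ℕ) : ℕ∞) < r
      · obtain ⟨i1, i2, i3⟩ := ih ((remainder α x).val :: acc) hl' hacc' hnd'
          (by rw [List.length_cons]; exact hc)
        rw [List.length_cons] at i1 i2 i3
        simp only [hc, if_true, Timed.bind_val, Timed.bind_cost, Timed.cons]
        refine ⟨by linarith, fun l' e => ?_, i3⟩
        obtain ⟨j1, j2, j3⟩ := i2 l' e
        exact ⟨j1, fun y hy => j2 (List.mem_cons_of_mem _ hy),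
          List.forall_mem_cons.mpr ⟨j2 List.mem_cons_self, j3⟩⟩
      · simp only [hc, if_false, Timed.pure_val, Timed.pure_cost]
        refine ⟨by nlinarith, by simp, fun _ => ?_⟩
        -- Giving up happens exactly on finding the `r`-th remainder, so `r` is finite and equals
        -- `acc.length + 1`.
        have hle : ((acc.length + 1 : ℕ) : ℕ∞) ≤ r := by
          rw [Nat.cast_add, Nat.cast_one]
          exact Order.add_one_le_of_lt hr
        exact ⟨acc.length + 1, le_antisymm (not_lt.mp hc) hle,
          hB _ hle (hcard _ hacc' hnd')⟩

/-- The starting points tried by SPEEDUP: few, found quickly, and either all remainders or all `r`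
equidistant points. -/
theorem periodSets_spec {V : Type*} {n : ℕ} (I : Fin n → Request V) (α σ : ℝ) {r : ℕ∞}
    (hr : r ≠ 0) (B : ℕ) (hB : ∀ c : ℕ, (c : ℕ∞) ≤ r → c ≤ (remainders I α).card → c ≤ B) :
    (periodSets I α σ r).val.length ≤ B ∧
    (periodSets I α σ r).cost ≤ 4 * n * B + 19 * n + 4 * B + 4 ∧
    ((∀ x, IsEndpoint I x → (remainder α x).val ∈ (periodSets I α σ r).val) ∨
      ∃ r' : ℕ, r = r' ∧ ∀ d < r', σ + d * (α / r') ∈ (periodSets I α σ r).val) := by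
  obtain ⟨h1, h2, h3⟩ := collect_spec α r (remainders I α) B hB (endpoints (List.ofFn I)).val []
    (fun x hx => mem_remainders.mpr ⟨x, (mem_endpoints_ofFn I x).mp hx, rfl⟩) (by simp) (by simp)
    (by simpa [pos_iff_ne_zero] using hr)
  rw [endpoints_length, List.length_ofFn, List.length_nil] at h1
  rw [List.length_nil] at h2 h3
  simp only [periodSets, Timed.bind_val, Timed.bind_cost, endpoints_cost, List.length_ofFn]
  cases hc : (collect α r [] 0 (endpoints (List.ofFn I)).val).val with
  | some l =>
    obtain ⟨j1, -, j3⟩ := h2 l hc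
    simp only [Timed.pure_val, Timed.pure_cost]
    exact ⟨j1, by nlinarith, Or.inl fun x hx => j3 x ((mem_endpoints_ofFn I x).mpr hx)⟩
  | none =>
    obtain ⟨r', rfl, hr'⟩ := h3 hc
    obtain ⟨j1, j2, j3⟩ := shifts_spec σ (α / r') r'
    simp only [Timed.bind_val, Timed.bind_cost, Timed.div, ENat.toNat_natCast, j1, j2]
    exact ⟨hr', by nlinarith, Or.inr ⟨r', rfl, j3⟩⟩

/-! ### Loops that keep the best run, and SPEEDUP -/

theorem IsRunOf.length_le {V : Type*} [MetricSpace V] {n : ℕ} {I : Fin n → Request V} {s : ℝ}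
    {R : Run n} (h : IsRunOf I s R) : R.length ≤ n := by
  simpa using h.1.length_le_card

/-- In at most `K` steps, `f` turns a run of `I` into one that is at least as good. -/
def Improves {V : Type*} [MetricSpace V] {n : ℕ} (I : Fin n → Request V) (s : ℝ) (K : ℕ)
    (f : Run n → Timed (Run n)) : Prop :=
  ∀ b, IsRunOf I s b →
    IsRunOf I s (f b).val ∧ b.length ≤ (f b).val.length ∧ (f b).cost ≤ K

theorem Improves.loop {V : Type*} [MetricSpace V] {n : ℕ} {I : Fin n → Request V} {s : ℝ} {K : ℕ}
    {β : Type} {f : Run n → β → Timed (Run n)} {l : List β}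
    (h : ∀ a ∈ l, Improves I s K fun b => f b a) :
    Improves I s (1 + l.length * (K + 1)) fun b => Timed.loop f b l := by
  induction l with
  | nil => exact fun b hb => ⟨hb, le_rfl, by simp [Timed.loop]⟩
  | cons a l ih =>
    intro b hb
    obtain ⟨h1, h2, h3⟩ := h a List.mem_cons_self b hb
    obtain ⟨i1, i2, i3⟩ := ih (fun a ha => h a (List.mem_cons_of_mem _ ha)) _ h1
    simp only [Timed.loop, List.length_cons]
    exact ⟨i1, h2.trans i2, by simp only at h3 i3; linarith⟩

/-- A lower bound on the profit that one iteration guarantees holds after the loop. -/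
theorem Improves.loop_of_mem {V : Type*} [MetricSpace V] {n : ℕ} {I : Fin n → Request V} {s : ℝ}
    {K : ℕ} {β : Type} {f : Run n → β → Timed (Run n)} {l : List β}
    (h : ∀ a ∈ l, Improves I s K fun b => f b a) {P : ℕ → Prop} (hP : Monotone P) {a : β}
    (ha : a ∈ l) (hPa : ∀ b, IsRunOf I s b → P (f b a).val.length) {b : Run n}
    (hb : IsRunOf I s b) : P (Timed.loop f b l).val.length := by
  induction l generalizing b with
  | nil => simp at ha
  | cons a' l ih =>
    have h' := fun a ha => h a (List.mem_cons_of_mem a' ha)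
    have h1 := (h a' List.mem_cons_self b hb).1
    rcases List.mem_cons.mp ha with rfl | ha
    · exact hP (Improves.loop h' _ h1).2.1 (hPa b hb)
    · exact ih h' ha h1

theorem Timed.longer_spec {α : Type} (a b : List α) :
    ((longer a b).val = a ∨ (longer a b).val = b) ∧ a.length ≤ (longer a b).val.length ∧
      b.length ≤ (longer a b).val.length := by
  unfold longer
  split_ifs with h
  · exact ⟨Or.inr rfl, h.le, le_rfl⟩
  · exact ⟨Or.inl rfl, le_rfl, not_lt.mp h⟩

/-- What SPEEDUP does for one set of periods. -/
def speedupStep {V : Type*} (alg : (n : ℕ) → TrimmedInstance V n → Timed (Run n)) (s : ℝ)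
    {n : ℕ} (I : Fin n → Request V) (α : ℝ) (j k : ℤ) (best : Run n) (δ : ℝ) : Timed (Run n) := do
  let slot ← Timed.table fun p => trim α δ j k (I p)
  let R ← alg n ⟨s, α, δ, fun p => (I p).loc, slot⟩
  Timed.longer best R

theorem speedup_eq {V : Type*} {alg : (n : ℕ) → TrimmedInstance V n → Timed (Run n)} {s : ℝ}
    {n : ℕ} (I : Fin n → Request V) {α : ℝ} {j k : ℤ} (r : ℕ∞) (σ : ℝ) (best : Run n) :
    speedup alg s r I α σ j k best =
    periodSets I α σ r >>= fun D => Timed.loop (speedupStep alg s I α j k) best D := rfl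

theorem speedupStep_val {V : Type*} {alg : (n : ℕ) → TrimmedInstance V n → Timed (Run n)} {s : ℝ}
    {n : ℕ} (I : Fin n → Request V) {α : ℝ} {j k : ℤ}
    (best : Run n) (δ : ℝ) : (speedupStep alg s I α j k best δ).val =
    (Timed.longer best (alg n (trimmed I s α δ j k)).val).val := rfl

theorem speedupStep_cost {V : Type*} {alg : (n : ℕ) → TrimmedInstance V n → Timed (Run n)} {s : ℝ}
    {n : ℕ} (I : Fin n → Request V) {α : ℝ} {j k : ℤ}
    (best : Run n) (δ : ℝ) : (speedupStep alg s I α j k best δ).cost =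
    16 * n + ((alg n (trimmed I s α δ j k)).cost +
      (best.length + (alg n (trimmed I s α δ j k)).val.length + 1)) := by
  have : (Timed.table fun p => trim α δ j k (I p)).cost = 16 * n := by
    simp [Timed.table, trim_cost, mul_comm]
  rw [← this]
  rfl

theorem improves_speedupStep {V : Type*} [MetricSpace V]
    {alg : (n : ℕ) → TrimmedInstance V n → Timed (Run n)} {γ : ℝ} {Γ : ℕ → ℕ}
    (halg : IsTrimmedRepairmanAlgorithm alg γ Γ) {s : ℝ} (hs : 0 < s) {n : ℕ}
    (I : Fin n → Request V) {α : ℝ} (hα : 0 < α) {j k : ℤ} (hj : 1 ≤ j ∧ j ≤ 2)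
    (hk : 1 ≤ k ∧ k ≤ 3) (δ : ℝ) :
    Improves I s (18 * n + Γ n + 1) fun b => speedupStep alg s I α j k b δ := by
  intro b hb
  obtain ⟨h1, -, h3⟩ := halg n (trimmed I s α δ j k) hs hα
  have h4 : IsRunOf I s (alg n (trimmed I s α δ j k)).val :=
    IsServiceRun.mono h1 (trimmed_window_subset I s hα δ hj hk)
  obtain ⟨h5, h6, -⟩ := Timed.longer_spec b (alg n (trimmed I s α δ j k)).val
  have := hb.length_le
  have := h4.length_le
  simp only [speedupStep_val, speedupStep_cost]
  refine ⟨?_, h6, by omega⟩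
  rcases h5 with h | h <;> rw [h] <;> assumption

theorem improves_speedup {V : Type*} [MetricSpace V]
    {alg : (n : ℕ) → TrimmedInstance V n → Timed (Run n)} {γ : ℝ} {Γ : ℕ → ℕ}
    (halg : IsTrimmedRepairmanAlgorithm alg γ Γ) {s : ℝ} (hs : 0 < s) {n : ℕ}
    (I : Fin n → Request V) {α : ℝ} (hα : 0 < α) {j k : ℤ} (hj : 1 ≤ j ∧ j ≤ 2)
    (hk : 1 ≤ k ∧ k ≤ 3) {r : ℕ∞} (hr : r ≠ 0) {B : ℕ}
    (hB : ∀ c : ℕ, (c : ℕ∞) ≤ r → c ≤ (remainders I α).card → c ≤ B) (hn : 0 < n)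
    (hΓ : n ≤ Γ n) (hB0 : 0 < B) (σ : ℝ) :
    Improves I s (60 * (B * Γ n)) (speedup alg s r I α σ j k) := by
  intro b hb
  obtain ⟨h1, h2, -⟩ := periodSets_spec I α σ hr B hB
  obtain ⟨i1, i2, i3⟩ := Improves.loop (l := (periodSets I α σ r).val)
    (fun δ _ => improves_speedupStep halg hs I hα hj hk δ) b hb
  simp only [speedup_eq, Timed.bind_val, Timed.bind_cost] at *
  refine ⟨i1, i2, ?_⟩
  have h3 := Nat.mul_le_mul_right (18 * n + Γ n + 1 + 1) h1
  have h4 : B * n ≤ B * Γ n := Nat.mul_le_mul_left B hΓ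
  have h5 : n ≤ B * n := Nat.le_mul_of_pos_left n hB0
  have h6 : B ≤ B * n := Nat.le_mul_of_pos_right B hn
  nlinarith

/-- Either `δ₀` itself is among the starting points tried, or all remainders are, and one of them
admits a shifted copy of `R`. The approximation guarantee then applies to that trimmed instance. -/
theorem profit_le_speedup {V : Type*} [MetricSpace V]
    {alg : (n : ℕ) → TrimmedInstance V n → Timed (Run n)} {γ : ℝ} {Γ : ℕ → ℕ}
    (halg : IsTrimmedRepairmanAlgorithm alg γ Γ) {s : ℝ} (hs : 0 < s) {n : ℕ}
    (I : Fin n → Request V) {α : ℝ} (hα : 0 < α) {j k : ℤ} (hj : 1 ≤ j ∧ j ≤ 2)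
    (hk : 1 ≤ k ∧ k ≤ 3) {r : ℕ∞} (hr : r ≠ 0) {B : ℕ}
    (hB : ∀ c : ℕ, (c : ℕ∞) ≤ r → c ≤ (remainders I α).card → c ≤ B) (hn : 0 < n)
    (hγ : 0 ≤ γ) {σ δ₀ : ℝ}
    (hδ₀ : ∀ r' : ℕ, r = r' → ∃ d < r', δ₀ = σ + d * (α / r')) {R : Run n}
    (hR : IsServiceRun (fun p => (I p).loc) (trimmed I s α δ₀ j k).window s R) {b : Run n}
    (hb : IsRunOf I s b) :
    (profit R : ℝ) ≤ γ * ((speedup alg s r I α σ j k b).val.length : ℕ) := by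
  obtain ⟨-, -, h3⟩ := periodSets_spec I α σ hr B hB
  obtain ⟨δ, hδ, R', hR', e⟩ : ∃ δ ∈ (periodSets I α σ r).val, ∃ R' : Run n,
      IsServiceRun (fun p => (I p).loc) (trimmed I s α δ j k).window s R' ∧
        profit R' = profit R := by
    rcases h3 with h3 | ⟨r', hr', h3⟩
    · obtain ⟨x₀, hx₀, R', hR', e⟩ := exists_remainder_run hn I s hα δ₀ j k hR
      exact ⟨_, h3 x₀ hx₀, R', hR', e⟩
    · obtain ⟨d, hd, rfl⟩ := hδ₀ r' hr'
      exact ⟨_, h3 d hd, R, hR, rfl⟩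
  rw [speedup_eq, Timed.bind_val]
  refine Improves.loop_of_mem (fun δ _ => improves_speedupStep halg hs I hα hj hk δ)
    (P := fun m => (profit R : ℝ) ≤ γ * (m : ℕ)) ?_ hδ ?_ hb
  · intro m m' hm h
    exact le_trans h (mul_le_mul_of_nonneg_left (by exact_mod_cast hm) hγ)
  · intro b hb
    rw [speedupStep_val, ← e]
    refine ((halg n (trimmed I s α δ j k) hs hα).2.1 R' hR').trans ?_
    refine mul_le_mul_of_nonneg_left ?_ hγ
    exact_mod_cast (Timed.longer_spec b (alg n (trimmed I s α δ j k)).val).2.2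

/-- An instance with a single request has a run of profit 1, which a negative `γ` could not bound.
-/
theorem IsTrimmedRepairmanAlgorithm.nonneg {V : Type*} [MetricSpace V]
    {alg : (n : ℕ) → TrimmedInstance V n → Timed (Run n)} {γ : ℝ} {Γ : ℕ → ℕ}
    (halg : IsTrimmedRepairmanAlgorithm alg γ Γ) (v : V) : 0 ≤ γ := by
  obtain ⟨-, h, -⟩ := halg 1 ⟨1, 1, 0, fun _ => v, fun _ => some 0⟩ one_pos one_pos
  have h1 := h [(0, 0)] ⟨by simp, by simp [TrimmedInstance.window], by simp⟩
  by_contra! hγ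
  have h2 : (profit ([(0, 0)] : Run 1) : ℝ) = 1 := by simp [profit]
  have h3 := mul_nonpos_of_nonpos_of_nonneg hγ.le
    (Nat.cast_nonneg (α := ℝ) (profit (alg 1 ⟨1, 1, 0, fun _ => v, fun _ => some 0⟩).val))
  linarith

/-! ### SPEEDUPW12 -/

/-- The first phase of SPEEDUPW12 from `best` on, for one starting point. -/
def phaseHalf {V : Type*} (alg : (n : ℕ) → TrimmedInstance V n → Timed (Run n)) (s : ℝ) (r : ℕ∞)
    {n : ℕ} (I : Fin n → Request V) (best : Run n) (i : ℕ) : Timed (Run n) := do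
  let σ ← Timed.div i 4
  Timed.loop (fun best (j : ℤ) =>
    Timed.loop (fun best (k : ℤ) => speedup alg s r I (1 / 2) σ j k best) best [1, 2, 3])
    best [1, 2]

/-- The second phase of SPEEDUPW12 from `best` on, for one starting point. -/
def phaseThreeQuarters {V : Type*} (alg : (n : ℕ) → TrimmedInstance V n → Timed (Run n)) (s : ℝ)
    (r : ℕ∞) {n : ℕ} (I : Fin n → Request V) (best : Run n) (i : ℕ) : Timed (Run n) := do
  let σ ← Timed.div i 4
  Timed.loop (fun best (j : ℤ) => speedup alg s r I (3 / 4) σ j 1 best) best [1, 2]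

/-- The third phase of SPEEDUPW12 from `best` on, for one starting point. -/
def phaseOne {V : Type*} (alg : (n : ℕ) → TrimmedInstance V n → Timed (Run n)) (s : ℝ)
    (r : ℕ∞) {n : ℕ} (I : Fin n → Request V) (best : Run n) (i : ℕ) : Timed (Run n) := do
  let σ ← Timed.div i 4
  speedup alg s r I 1 σ 1 1 best

theorem speedupW12_eq {V : Type*} (alg : (n : ℕ) → TrimmedInstance V n → Timed (Run n)) (s : ℝ)
    (r : ℕ∞) {n : ℕ} (I : Fin n → Request V) : speedupW12 alg s r I =
      Timed.loop (phaseHalf alg s r I) [] [0, 1] >>= fun best =>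
      Timed.loop (phaseThreeQuarters alg s r I) best [0, 1, 2] >>= fun best =>
      Timed.loop (phaseOne alg s r I) best [0, 1, 2, 3] := rfl

theorem Improves.bind {V : Type*} [MetricSpace V] {n : ℕ} {I : Fin n → Request V} {s : ℝ} {K : ℕ}
    {β : Type} {f : β → Run n → Timed (Run n)} (x : Timed β) (h : Improves I s K (f x.val)) :
    Improves I s (x.cost + K) fun b => x >>= fun a => f a b := by
  intro b hb
  obtain ⟨h1, h2, h3⟩ := h b hb
  exact ⟨h1, h2, Nat.add_le_add_left h3 _⟩

theorem isRunOf_nil {V : Type*} [MetricSpace V] {n : ℕ} (I : Fin n → Request V) (s : ℝ) :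
    IsRunOf I s [] := by
  simp [IsRunOf, IsServiceRun]

/-- The guarantee needs only the first call, with length 1/2, `σ = 0` and `j = k = 1`; later calls
cannot lose profit. The cost is that of 12 + 6 + 4 = 22 calls at `60 * (B * Γ n)` each, plus loop
overhead. Stating `hB` through all `c` below both bounds treats finite and infinite `r` alike. -/
theorem speedupW12_spec {V : Type*} [MetricSpace V]
    {alg : (n : ℕ) → TrimmedInstance V n → Timed (Run n)} {γ : ℝ} {Γ : ℕ → ℕ}
    (halg : IsTrimmedRepairmanAlgorithm alg γ Γ) {s : ℝ} (hs : 0 < s) {n : ℕ}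
    (I : Fin n → Request V) {r : ℕ∞} (hr : r ≠ 0) (hn : 0 < n) (hΓ : n ≤ Γ n) {B : ℕ}
    (hB0 : 0 < B) (hB : ∀ α : ℝ, 0 < α → (∃ q : ℤ, q * α = 3) →
      ∀ c : ℕ, (c : ℕ∞) ≤ r → c ≤ (remainders I α).card → c ≤ B) :
    IsRunOf I s (speedupW12 alg s r I).val ∧
    (speedupW12 alg s r I).cost ≤ 1420 * (B * Γ n) ∧
    ∀ δ : ℝ, (∀ r' : ℕ, r = r' → ∃ d < r', δ = d / (2 * r')) → ∀ R : Run n,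
      IsServiceRun (fun p => (I p).loc) (trimmed I s (1 / 2) δ 1 1).window s R →
      (profit R : ℝ) ≤ γ * profit (speedupW12 alg s r I).val := by
  have hγ : 0 ≤ γ := halg.nonneg (I ⟨0, hn⟩).loc
  have hB1 := hB (1 / 2) (by norm_num) ⟨6, by norm_num⟩
  have hB2 := hB (3 / 4) (by norm_num) ⟨4, by norm_num⟩
  have hB3 := hB 1 (by norm_num) ⟨3, by norm_num⟩
  set K := 60 * (B * Γ n) with hK
  have a1 : ∀ σ : ℝ, ∀ j : ℤ, 1 ≤ j ∧ j ≤ 2 → ∀ k ∈ [(1 : ℤ), 2, 3],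
      Improves I s K fun b => speedup alg s r I (1 / 2) σ j k b := by
    intro σ j hj k hk
    refine improves_speedup halg hs I (by norm_num) hj ?_ hr hB1 hn hΓ hB0 σ
    simp only [List.mem_cons, List.not_mem_nil, or_false] at hk
    omega
  have a2 : ∀ σ : ℝ, ∀ j ∈ [(1 : ℤ), 2], Improves I s (1 + 3 * (K + 1)) fun b =>
      Timed.loop (fun best (k : ℤ) => speedup alg s r I (1 / 2) σ j k best) b [1, 2, 3] := by
    intro σ j hj
    refine Improves.loop (a1 σ j ?_)
    simp only [List.mem_cons, List.not_mem_nil, or_false] at hj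
    omega
  have a3 : ∀ i ∈ [0, 1], Improves I s (1 + (1 + 2 * (1 + 3 * (K + 1) + 1)))
      fun b => phaseHalf alg s r I b i :=
    fun i _ => Improves.bind (Timed.div i 4) (Improves.loop (a2 _))
  have b1 : ∀ σ : ℝ, ∀ j ∈ [(1 : ℤ), 2],
      Improves I s K fun b => speedup alg s r I (3 / 4) σ j 1 b := by
    intro σ j hj
    refine improves_speedup halg hs I (by norm_num) ?_ (by norm_num) hr hB2 hn hΓ hB0 σ
    simp only [List.mem_cons, List.not_mem_nil, or_false] at hj
    omega
  have b3 : ∀ i ∈ [0, 1, 2], Improves I s (1 + (1 + 2 * (K + 1))) fun b =>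
      phaseThreeQuarters alg s r I b i :=
    fun i _ => Improves.bind (Timed.div i 4) (Improves.loop (b1 _))
  have c3 : ∀ i ∈ [0, 1, 2, 3], Improves I s (1 + K) fun b => phaseOne alg s r I b i :=
    fun i _ => Improves.bind (Timed.div i 4) (improves_speedup halg hs I (by norm_num)
      (by norm_num) (by norm_num) hr hB3 hn hΓ hB0 _)
  have h0 := isRunOf_nil I s
  obtain ⟨d1, d2, d3⟩ := Improves.loop a3 _ h0
  obtain ⟨e1, e2, e3⟩ := Improves.loop b3 _ d1
  obtain ⟨f1, f2, f3⟩ := Improves.loop c3 _ e1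
  rw [speedupW12_eq]
  simp only [Timed.bind_val, Timed.bind_cost]
  refine ⟨f1, ?_, fun δ hδ R hR => ?_⟩
  · simp only [List.length_cons, List.length_nil] at d3 e3 f3
    have : 1 ≤ B * Γ n := Nat.mul_pos hB0 (hn.trans_le hΓ)
    omega
  · obtain ⟨P, hPiff⟩ : ∃ P : ℕ → Prop, ∀ m, P m ↔ (profit R : ℝ) ≤ γ * m :=
      ⟨_, fun _ => Iff.rfl⟩
    have hP : Monotone P := by
      intro m m' hm h
      rw [hPiff] at h
      exact (hPiff m').mpr (h.trans (mul_le_mul_of_nonneg_left (by exact_mod_cast hm) hγ))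
    obtain ⟨σ, hσ⟩ : ∃ σ, σ = (Timed.div ((0 : ℕ) : ℝ) 4).val := ⟨_, rfl⟩
    have hσ0 : σ = 0 := by simp [hσ, Timed.div]
    have p1 : ∀ b, IsRunOf I s b → P (speedup alg s r I (1 / 2) σ 1 1 b).val.length := by
      intro b hb
      rw [hPiff]
      refine profit_le_speedup halg hs I (by norm_num) (by norm_num) (by norm_num) hr hB1 hn hγ
        ?_ hR hb
      intro r' hr'
      obtain ⟨d, hd, rfl⟩ := hδ r' hr'
      refine ⟨d, hd, ?_⟩
      rw [hσ0, zero_add, div_div, mul_one_div]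
    have p2 : ∀ b, IsRunOf I s b → P (Timed.loop (fun best (k : ℤ) =>
        speedup alg s r I (1 / 2) σ 1 k best) b [1, 2, 3]).val.length := by
      intro b hb
      exact Improves.loop_of_mem (P := P) (f := fun best (k : ℤ) =>
        speedup alg s r I (1 / 2) σ 1 k best) (a1 σ 1 (by norm_num)) hP List.mem_cons_self p1 hb
    have p3 : ∀ b, IsRunOf I s b → P (phaseHalf alg s r I b 0).val.length := by
      intro b hb
      rw [phaseHalf, Timed.bind_val, ← hσ]
      exact Improves.loop_of_mem (P := P) (f := fun best (j : ℤ) => Timed.loop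
        (fun best (k : ℤ) => speedup alg s r I (1 / 2) σ j k best) best [1, 2, 3])
        (a2 σ) hP List.mem_cons_self p2 hb
    refine (hPiff _).mp ?_
    refine hP (e2.trans f2) ?_
    exact Improves.loop_of_mem (P := P) a3 hP List.mem_cons_self p3 h0

/-! ### The approximation ratio and the main theorem -/

/-- SPEEDUPW12 approximates a unit-speed run on windows in `W_2`. -/
theorem profitOn_le {V : Type*} [MetricSpace V] {n : ℕ} (I : Fin n → Request V) {s : ℝ}
    (hs3 : 3 ≤ s) (hs5 : s ≤ 5) {r : ℕ∞} (hr : r ≠ 0)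
    (hq : ∀ r' : ℕ, r = r' → ∃ q : ℕ, s = q / r') {L : ℝ}
    (hL : ∀ δ : ℝ, (∀ r' : ℕ, r = r' → ∃ d < r', δ = d / (2 * r')) → ∀ R : Run n,
      IsServiceRun (fun p => (I p).loc) (trimmed I s (1 / 2) δ 1 1).window s R →
      (profit R : ℝ) ≤ L) {R : Run n} (hR : IsRunOf I 1 R) :
    (profitOn {p | ∀ δ ∈ startingPoints r, p ∈ WSet I (1 / 2) δ 2} R : ℝ) * (s - 1) ≤ 4 * L := by
  classical
  set S : Finset (Fin n) := Finset.univ.filter fun p =>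
    (∀ δ ∈ startingPoints r, p ∈ WSet I (1 / 2) δ 2) ∧ ∃ t, (p, t) ∈ R with hS
  have hcard : profitOn {p | ∀ δ ∈ startingPoints r, p ∈ WSet I (1 / 2) δ 2} R = S.card := by
    rw [profitOn, ← Set.ncard_coe_finset]
    congr 1
    ext p
    simp [hS]
  rw [hcard]
  have key : ∀ N : ℕ, 0 < N → (∀ r' : ℕ, r = r' → N = r') →
      (S.card : ℝ) * (N * multiplicity s) ≤ 4 * N * L + S.card * (⌈2 * N * margin s⌉₊ : ℕ) := by
    intro N hN hNr
    have hN' : (0 : ℝ) < N := by exact_mod_cast hN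
    have hmem : ∀ d < N, (d : ℝ) / (2 * N) ∈ startingPoints r := by
      intro d hd
      have hd' : (d : ℝ) < N := by exact_mod_cast hd
      refine ⟨⟨by positivity, ?_⟩, fun r' hr' => ⟨d, by rw [hNr r' hr']⟩⟩
      rw [div_lt_iff₀ (by positivity)]
      linarith
    obtain ⟨d, hd, R', hR', h⟩ := exists_trimmed_run I hs3 hs5 hN hR S
      (fun p hp => (Finset.mem_filter.mp hp).2.2)
      (fun p hp d hd => (Finset.mem_filter.mp hp).2.1 _ (hmem d hd))
    have h1 := hL _ (fun r' hr' => ⟨d, by rwa [← hNr r' hr'], by rw [hNr r' hr']⟩) R' hR'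
    have h2 : (S.card : ℝ) * (N * multiplicity s) ≤
        4 * N * profit R' + S.card * (⌈2 * N * margin s⌉₊ : ℕ) := by exact_mod_cast h
    have h3 : 4 * (N : ℝ) * profit R' ≤ 4 * N * L := by gcongr
    linarith
  have hms := multiplicity_sub_margin s
  have hz : 0 ≤ margin s := by unfold margin; split_ifs <;> linarith
  induction r with
  | coe r' =>
    have hr' : 0 < r' := Nat.pos_of_ne_zero (by exact_mod_cast hr)
    have hr'' : (0 : ℝ) < r' := by exact_mod_cast hr'
    have h := key r' hr' (fun _ h => by exact_mod_cast h)
    obtain ⟨q, hq⟩ := hq r' rfl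
    have hq' : (r' : ℝ) * s = q := by rw [hq]; field_simp
    -- Rounding loses nothing: as `r' * s = q`, the number is the integer `4 r' - q` or `5 r' - q`.
    have hceil : ((⌈2 * r' * margin s⌉₊ : ℕ) : ℝ) ≤ 2 * r' * margin s := by
      obtain ⟨m, hm⟩ : ∃ m : ℕ, 2 * r' * margin s = m := by
        unfold margin
        split_ifs with h4
        · refine ⟨4 * r' - q, ?_⟩
          rw [Nat.cast_sub (by
            have : (q : ℝ) ≤ 4 * r' := by nlinarith
            exact_mod_cast this)]
          push_cast
          linarith
        · refine ⟨5 * r' - q, ?_⟩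
          rw [Nat.cast_sub (by
            have : (q : ℝ) ≤ 5 * r' := by nlinarith
            exact_mod_cast this)]
          push_cast
          linarith
      rw [hm, Nat.ceil_natCast]
    have h1 := mul_le_mul_of_nonneg_left hceil (Nat.cast_nonneg (α := ℝ) S.card)
    have h2 : (r' : ℝ) * (S.card * (s - 1)) ≤ r' * (4 * L) := by
      rw [← hms]
      linarith
    exact le_of_mul_le_mul_left h2 hr''
  | top =>
    by_contra! hlt
    -- The ceiling costs at most `S.card` in total, whereas the assumed gap is multiplied by `N`;
    -- this `N` makes the gap larger.
    obtain ⟨N, hN⟩ := exists_nat_gt ((S.card : ℝ) / (S.card * (s - 1) - 4 * L))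
    rw [div_lt_iff₀ (by linarith)] at hN
    have hN0 : 0 < N := by
      rcases Nat.eq_zero_or_pos N with rfl | h
      · have := Nat.cast_nonneg (α := ℝ) S.card
        simp at hN
        linarith
      · exact h
    have h := key N hN0 (fun r' h => absurd h.symm (ENat.natCast_ne_top r'))
    have hceil := (Nat.ceil_lt_add_one (a := 2 * N * margin s) (by positivity)).le
    have h1 := mul_le_mul_of_nonneg_left hceil (Nat.cast_nonneg (α := ℝ) S.card)
    rw [← hms] at hN
    linarith

end Repairman

end

theorem mainTheorem5 :
    ∃ C : ℕ, ∀ (V : Type*) [MetricSpace V]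
      (alg : (n : ℕ) → Repairman.TrimmedInstance V n → Repairman.Timed (Repairman.Run n))
      (γ : ℝ) (Γ : ℕ → ℕ),
      Repairman.IsTrimmedRepairmanAlgorithm alg γ Γ → (∀ n, n ≤ Γ n) →
      ∀ (s : ℝ) (r : ℕ∞), 3 ≤ s → s ≤ 5 → r ≠ 0 →
      (∀ r' : ℕ, r = r' → ∃ q : ℕ, s = q / r') →
      ∀ (n : ℕ) (I : Fin n → Repairman.Request V), 0 < n →
      (∀ p, 1 ≤ (I p).len ∧ (I p).len < 2) →
        Repairman.IsRunOf I s (Repairman.speedupW12 alg s r I).val ∧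
        (∀ R : Repairman.Run n, Repairman.IsRunOf I 1 R →
          (Repairman.profitOn
              {p | ∀ δ ∈ Repairman.startingPoints r, p ∈ Repairman.WSet I (1 / 2) δ 2} R : ℝ) ≤
            4 * γ / (s - 1) * Repairman.profit (Repairman.speedupW12 alg s r I).val) ∧
        ((Repairman.speedupW12 alg s r I).cost : ℕ∞) ≤
          C * min r (Repairman.numPeriodSets I (1 / 2)) * Γ n := by
  -- This is `1420 * 6`, the 6 coming from the comparison of remainders for different period
  -- lengths.
  refine ⟨8520, ?_⟩
  intro V _ alg γ Γ halg hΓ s r hs3 hs5 hr hq n I hn hI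
  set k := (Repairman.remainders I (1 / 2)).card with hk
  have hk0 : 0 < k := Finset.card_pos.mpr
    ⟨_, Repairman.mem_remainders.mpr ⟨_, ⟨⟨0, hn⟩, Or.inl rfl⟩, rfl⟩⟩
  obtain ⟨M, hM⟩ : ∃ M : ℕ, (M : ℕ∞) = min r k :=
    ENat.ne_top_iff_exists.mp (ne_top_of_le_ne_top (ENat.natCast_ne_top k) (min_le_right _ _))
  have hM0 : 0 < M := by
    have : (0 : ℕ∞) < M := by
      rw [hM, lt_min_iff]
      exact ⟨pos_iff_ne_zero.mpr hr, by exact_mod_cast hk0⟩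
    exact_mod_cast this
  have hMm : (M : ℕ∞) ≤ min r (Repairman.numPeriodSets I (1 / 2)) := by
    rw [hM]
    exact min_le_min le_rfl (Repairman.card_remainders_le_numPeriodSets I fun p => (hI p).1)
  obtain ⟨h1, h2, h3⟩ := Repairman.speedupW12_spec halg (by linarith : 0 < s) I hr hn (hΓ n)
    (B := 6 * M) (by omega) (by
      rintro α hα ⟨q, hqα⟩ c hcr hc
      have hc6 := hc.trans (Repairman.card_remainders_le I hα hqα)
      rcases min_choice r (k : ℕ∞) with h | h
      · rw [← h, ← hM] at hcr
        have : c ≤ M := by exact_mod_cast hcr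
        omega
      · rw [h] at hM
        have : M = k := by exact_mod_cast hM
        omega)
  refine ⟨h1, fun R hR => ?_, ?_⟩
  · have h := Repairman.profitOn_le I hs3 hs5 hr hq h3 hR
    rw [div_mul_eq_mul_div, le_div_iff₀ (by linarith)]
    linarith
  · calc ((Repairman.speedupW12 alg s r I).cost : ℕ∞)
        ≤ ((1420 * (6 * M * Γ n) : ℕ) : ℕ∞) := by exact_mod_cast h2
      _ = (8520 : ℕ) * (M : ℕ∞) * Γ n := by
          norm_cast
          ring
      _ ≤ _ := by gcongr
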